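/- Let $q,t$ be indeterminates, $M=(1-t)(1-q)$, and let $\Lambda$ be the algebra of symmetric functions in the infinite alphabet $X=x_1+x_2+\cdots$ with coefficients in $\mathbb{Q}(q,t)$. For an expression $E$ put $\Omega[E]=\exp\big(\sum_{k\ge 1}p_k[E]/k\big)$, and for $F\in\Lambda$ let $F[E]$ denote plethystic substitution. In particular $p_k[X+\sum_i M/z_i]=p_k[X]+\sum_i(1-t^k)(1-q^k)z_i^{-k}$, $\;\Omega[-zX]=\sum_{i\ge 0}(-z)^ie_i[X]$, and $\Omega[-uM]=\frac{(1-u)(1-qtu)}{(1-tu)(1-qu)}$ expanded in powers of $u$. Let $D_0$ be the operator on $\Lambda$ given by $D_0F[X]=F[X+\tfrac{M}{z}]\sum_{i\ge0}(-z)^ie_i[X]\,\big|_{z^0}$, and let $\underline{e}_1$ be multiplication by $e_1$. For co-prime integers $m,n\ge 1$ define $\mathrm{Split}(m,n)=(a,b)+(c,d)$ as follows: if $m,n>1$, then $(a,b)$ is the unique pair of integers with $1\le a\le m-1$, $1\le b\le n-1$, $mb+1=na$, and $(c,d)=(m,n)-(a,b)$; furthermore $\mathrm{Split}(1,n)=(1,n-1)+(0,1)$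 and $\mathrm{Split}(m,1)=(1,0)+(m-1,1)$. Define operators $Q_{m,n}$ on $\Lambda$ recursively by $Q_{1,0}=D_0$, $Q_{0,1}=-\underline{e}_1$ and $$Q_{m,n}=\tfrac1M[Q_{c,d},Q_{a,b}]=\tfrac1M\big(Q_{c,d}Q_{a,b}-Q_{a,b}Q_{c,d}\big),\qquad \mathrm{Split}(m,n)=(a,b)+(c,d).$$ For integers $m,n\ge1$ define the Negut operator $\mathbf N_{m,n}$ on $\Lambda$ by $$\mathbf N_{m,n}F[X]=F\Big[X+\sum_{i=1}^m\tfrac{M}{z_i}\Big]\prod_{i=1}^m\Omega[-z_iX]\prod_{i=1}^m\frac1{z_i^{e_i(m,n)}}\prod_{i=1}^{m-1}\frac1{1-qt\,z_i/z_{i+1}}\prod_{1\le i<j\le m}\Omega\big[-\tfrac{z_i}{z_j}M\big]\;\Big|_{z_1^0z_2^0\cdots z_m^0},$$ where $e_i(m,n)=\lfloor i\tfrac nm\rfloor-\lfloor (i-1)\tfrac nm\rfloor$, the factors $1/(1-qt\,z_i/z_{i+1})$ and $\Omega[-\tfrac{z_i}{z_j}M]$ ($i<j$) are expanded in non-negative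 powers of $z_i/z_{i+1}$ and $z_i/z_j$ respectively, and $|_{z_1^0\cdots z_m^0}$ takes the constant term in $z_1,\dots,z_m$. **Theorem.** For every pair of co-prime positive integers $(m,n)$ with $m\le 4$, $$Q_{m,n}=\mathbf N_{m,n}$$ as operators on $\Lambda$, that is, $Q_{m,n}F=\mathbf N_{m,n}F$ for every $F\in\Lambda$. -/

import Mathlib

noncomputable section

namespace SymFun

open Finset

section Operators

variable {K : Type*} [Field K]

/-- The algebra `Λ` of symmetric functions of an infinite alphabet `X` with coefficients in a field
`K` of characteristic zero: the polynomial algebra on the power sums `p_1, p_2, p_3, …`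
(the power sums are algebraically independent and generate `Λ`). -/
abbrev Sym (K : Type*) [Field K] : Type _ := MvPolynomial ℕ+ K

/-- The power sum `p_k = p_k[X]`. -/
def p (k : ℕ+) : Sym K := MvPolynomial.X k

/-- The plethystic exponential `Ω[E] = exp (∑_{k ≥ 1} p_k[E] / k)`, for an expression `E` such that
`p_k[E] = E_k u^k`, as a power series in the variable `u`. -/
def Omega [CharZero K] (E : ℕ+ → Sym K) : PowerSeries (Sym K) :=
  (PowerSeries.exp (Sym K)).subst
    (PowerSeries.mk fun k : ℕ => if h : 0 < k then (k : ℚ)⁻¹ • E (k.toPNat h) else 0)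

/-- `Ω[-uX]`, as a power series in `u`. -/
def OmegaNegX [CharZero K] : PowerSeries (Sym K) := Omega fun k => -p k

/-- The elementary symmetric function `e_i = e_i[X]`, through its generating function
`∑_i e_i u^i = exp (∑_{k ≥ 1} (-1)^(k-1) p_k u^k / k)`. -/
def e [CharZero K] (i : ℕ) : Sym K :=
  PowerSeries.coeff i (Omega fun k : ℕ+ => (-1) ^ ((k : ℕ) - 1) * p k)

/-- `p_k[M] = (1 - t^k) (1 - q^k)`, where `M = (1 - t) (1 - q)`. -/
def pM (q t : K) (k : ℕ+) : K := (1 - t ^ (k : ℕ)) * (1 - q ^ (k : ℕ))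

/-- `Ω[-uM]`, as a power series in `u`. -/
def OmegaNegM [CharZero K] (q t : K) : PowerSeries (Sym K) := Omega fun k => -MvPolynomial.C (pM q t k)

/-- The plethystic substitution `F[X] ↦ F[X + E]`, where `E` is given by the sequence
`k ↦ p_k[E]` of (multivariate Laurent) series over `Λ`: it is the ring homomorphism which is the
identity on scalars in `K` and maps `p_k` to `p_k + p_k[E]`. -/
def shift {Γ : Type*} [AddCommMonoid Γ] [PartialOrder Γ] [IsOrderedCancelAddMonoid Γ]
    (E : ℕ+ → HahnSeries Γ (Sym K)) : Sym K →+* HahnSeries Γ (Sym K) :=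
  MvPolynomial.eval₂Hom (HahnSeries.C.comp MvPolynomial.C) fun k => HahnSeries.C (p k) + E k

theorem shift_smul {Γ : Type*} [AddCommMonoid Γ] [PartialOrder Γ] [IsOrderedCancelAddMonoid Γ]
    (E : ℕ+ → HahnSeries Γ (Sym K)) (c : K) (F : Sym K) :
    shift E (c • F) = HahnSeries.C (MvPolynomial.C c) * shift E F := by
  rw [MvPolynomial.smul_eq_C_mul, map_mul]
  simp [shift]

/-- The operator `D_k`, with `D_k F[X] = F[X + M/z] ∑_{i ≥ 0} (-z)^i e_i[X] |_{z^k}`; the right-hand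
side is a Laurent series in `z` over `Λ`, and `|_{z^k}` takes the coefficient of `z^k`. -/
def D [CharZero K] (q t : K) (k : ℤ) : Module.End K (Sym K) where
  toFun F :=
    ((shift (fun j : ℕ+ => (HahnSeries.single (-(j : ℤ)) (MvPolynomial.C (pM q t j)) :
          LaurentSeries (Sym K))) F) *
      HahnSeries.ofPowerSeries ℤ (Sym K)
        (PowerSeries.mk fun i => (-1) ^ i * e i)).coeff k
  map_add' F G := by simp [add_mul]
  map_smul' c F := by
    rw [shift_smul, mul_assoc, HahnSeries.C_mul_eq_smul, HahnSeries.coeff_smul,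
      smul_eq_mul, RingHom.id_apply, MvPolynomial.smul_eq_C_mul]

/-- `underline G`: the operator of multiplication by the symmetric function `G`. -/
def mulBy (G : Sym K) : Module.End K (Sym K) := LinearMap.mulLeft K G

theorem exists_split {m n : ℕ} (hm : 1 < m) (hn : 1 < n) (h : m.Coprime n) :
    ∃ r : ℕ × ℕ, (1 ≤ r.1 ∧ r.1 ≤ m - 1) ∧ (1 ≤ r.2 ∧ r.2 ≤ n - 1) ∧ m * r.2 + 1 = n * r.1 := by
  obtain ⟨a, ham, ha⟩ := Nat.exists_mul_mod_eq_one_of_coprime h.symm hm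
  have key := Nat.div_add_mod (n * a) m
  rw [ha] at key
  have ha1 : 1 ≤ a := by
    rcases Nat.eq_zero_or_pos a with h0 | h0
    · simp [h0] at key
    · exact h0
  refine ⟨(a, n * a / m), ⟨ha1, Nat.le_sub_one_of_lt ham⟩, ⟨?_, ?_⟩, key⟩
  · by_contra hb
    change ¬ 1 ≤ n * a / m at hb
    have hb0 : n * a / m = 0 := Nat.lt_one_iff.mp (not_le.mp hb)
    rw [hb0] at key
    have : n ≤ n * a := Nat.le_mul_of_pos_right n ha1
    omega
  · have hlt : n * a / m < n := by
      rw [Nat.div_lt_iff_lt_mul (by omega)]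
      exact Nat.mul_lt_mul_of_pos_left ham (by omega)
    show n * a / m ≤ n - 1
    omega

open Classical in
/-- The lattice point `(a, b)` of `Split (m, n) = (a, b) + (c, d)`, for co-prime `m, n ≥ 1`.
For `m, n > 1` it is the unique pair with `1 ≤ a ≤ m - 1`, `1 ≤ b ≤ n - 1` and `m b + 1 = n a`;
moreover `Split (1, n) = (1, n - 1) + (0, 1)` and `Split (m, 1) = (1, 0) + (m - 1, 1)`.
The last branch is never reached for co-prime `m, n ≥ 1`. -/
def split (m n : ℕ) : ℕ × ℕ :=
  if m = 1 then (1, n - 1)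
  else if n = 1 then (1, 0)
  else if h : ∃ r : ℕ × ℕ,
      (1 ≤ r.1 ∧ r.1 ≤ m - 1) ∧ (1 ≤ r.2 ∧ r.2 ≤ n - 1) ∧ m * r.2 + 1 = n * r.1 then h.choose
  else (0, 0)

theorem split_lt {m n : ℕ} (h : 1 ≤ m ∧ 1 ≤ n ∧ m.Coprime n) :
    (split m n).1 + (split m n).2 < m + n ∧
      (m - (split m n).1) + (n - (split m n).2) < m + n := by
  obtain ⟨hm, hn, hc⟩ := h
  unfold split
  split_ifs with h1 h2 h3
  · constructor <;> simp <;> omega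
  · constructor <;> simp <;> omega
  · have := h3.choose_spec
    constructor <;> omega
  · exact absurd (exists_split (by omega) (by omega) hc) h3

/-- The operators `Q_{m,n}` for co-prime `(m, n)`: `Q_{m,n} = (1/M) [Q_{c,d}, Q_{a,b}]` if
`m, n ≥ 1` and `Split (m, n) = (a, b) + (c, d)`, with base cases `Q_{1,0} = D_0` and
`Q_{0,1} = -underline e_1`. (Junk value `0` for other pairs, which the recursion never meets when
it starts from a co-prime pair.) -/
def Q [CharZero K] (q t : K) (m n : ℕ) : Module.End K (Sym K) :=
  if _h : 1 ≤ m ∧ 1 ≤ n ∧ m.Coprime n then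
    ((1 - t) * (1 - q))⁻¹ •
      (Q q t (m - (split m n).1) (n - (split m n).2) * Q q t (split m n).1 (split m n).2 -
        Q q t (split m n).1 (split m n).2 * Q q t (m - (split m n).1) (n - (split m n).2))
  else if m = 1 ∧ n = 0 then D q t 0
  else if m = 0 ∧ n = 1 then -mulBy (e 1)
  else 0
termination_by m + n
decreasing_by
  all_goals first
    | exact (split_lt _h).1
    | exact (split_lt _h).2

/-- The ring of formal series in `z_1, …, z_m` over `Λ`, with integer exponents, whose support is
well-ordered for the lexicographic order on exponent vectors. In this ring `z_i` for all `i` and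
`z_i / z_j` for all `i < j` are infinitesimal, so that power series in them make sense. -/
abbrev Series (K : Type*) [Field K] (m : ℕ) : Type _ := HahnSeries (Lex (Fin m → ℤ)) (Sym K)

/-- The monomial `z^a = ∏_i z_i^{a_i}`. -/
def mono {m : ℕ} (a : Fin m → ℤ) : Series K m := HahnSeries.single (toLex a) 1

/-- The monomial `z_i / z_j`. -/
def ratio {m : ℕ} (i j : Fin m) : Series K m := mono (Pi.single i 1 - Pi.single j 1)

/-- The series `f(x) = ∑_n f_n x^n`, for a power series `f` over `Λ` and an infinitesimal `x`. -/
def evalAt {m : ℕ} (f : PowerSeries (Sym K)) (x : Series K m) : Series K m :=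
  PowerSeries.heval x f

/-- The series whose constant term in `z_1, …, z_m` is `N_{m,n} F[X]`:
`F[X + ∑_i M/z_i] ∏_i Ω[-z_i X] ∏_i z_i^{-e_i(m,n)} ∏_{i<m} 1/(1 - q t z_i/z_{i+1})
∏_{i<j} Ω[-M z_i/z_j]`, where `e_i(m,n) = ⌊i n/m⌋ - ⌊(i-1) n/m⌋` for `1 ≤ i ≤ m`.
Here `1/(1 - q t u)` is the geometric series `∑_r (q t)^r u^r`. (The indices `i : Fin m` start
at `0`, so that `i` below corresponds to the subscript `i + 1`.) -/
def negutSeries [CharZero K] (q t : K) (m n : ℕ) (F : Sym K) : Series K m :=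
  shift (fun k : ℕ+ => ∑ i : Fin m,
      HahnSeries.C (MvPolynomial.C (pM q t k)) * mono (Pi.single i (-(k : ℤ)))) F *
    (∏ i : Fin m, evalAt OmegaNegX (mono (Pi.single i 1))) *
    mono (fun i : Fin m => -((((i : ℕ) + 1) * n / m : ℕ) - ((i : ℕ) * n / m : ℕ) : ℤ)) *
    (∏ x : Fin m × Fin m with (x.1 : ℕ) + 1 = x.2,
      evalAt (PowerSeries.mk fun r => MvPolynomial.C ((q * t) ^ r)) (ratio x.1 x.2)) *
    (∏ x : Fin m × Fin m with x.1 < x.2, evalAt (OmegaNegM q t) (ratio x.1 x.2))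

/-- The Negut operator `N_{m,n}`: the constant term of `negutSeries`. -/
def N [CharZero K] (q t : K) (m n : ℕ) : Module.End K (Sym K) where
  toFun F := (negutSeries q t m n F).coeff 0
  map_add' F G := by simp [negutSeries, add_mul]
  map_smul' c F := by
    simp only [negutSeries]
    rw [shift_smul]
    simp only [mul_assoc]
    rw [HahnSeries.C_mul_eq_smul, HahnSeries.coeff_smul, smul_eq_mul, RingHom.id_apply,
      MvPolynomial.smul_eq_C_mul]

end Operators

/-- The field `ℚ(q, t)` of rational functions in two indeterminates. -/
abbrev Qqt : Type := FractionRing (MvPolynomial (Fin 2) ℚ)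

/-- The indeterminate `q`. -/
def qVar : Qqt := algebraMap (MvPolynomial (Fin 2) ℚ) Qqt (MvPolynomial.X 0)

/-- The indeterminate `t`. -/
def tVar : Qqt := algebraMap (MvPolynomial (Fin 2) ℚ) Qqt (MvPolynomial.X 1)

end SymFun

end

noncomputable section

/-!
Both families act through kernels: a Laurent series `κ` in `z_1, …, z_m` defines the operator
sending `F` to the constant term of
`κ · ∏_{i<j} Ω[-(z_i / z_j) M] · F[X + ∑ M / z_i] · ∏ Ω[-z_i X]`. Two such operators compose by
juxtaposing their kernels, because shifting `Ω[-z X]` by `M / w` produces exactly the factor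
`Ω[-(z / w) M]`. Since `D_k` has kernel `z^{-k}`, the recursion for `Q_{m, n}` with
`n ≡ ±1 (mod m)` becomes a statement about the kernel of one commutator, and `m ≤ 4` forces
`n ≡ ±1 (mod m)`. After multiplication by the factors `Ω[-(z_i / z_j) M]`, that kernel is a
combination of series which are antisymmetric under exchanging two adjacent variables. The
remaining factors `F[X + ∑ M / z_i] · ∏ Ω[-z_i X]` are symmetric, so the constant terms vanish.
The two residues `±1` are interchanged by the reversal `z_i ↦ 1 / z_{m + 1 - i}`, which preserves
all ratios `z_i / z_j` with `i < j` up to relabelling.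
-/

namespace SymFun

open Finset

section PlethysticExp

open PowerSeries

variable {R : Type*} [CommRing R]

/-- The geometric series `1 / (1 - c u)`. -/
def geomSeries (c : R) : PowerSeries R :=
  PowerSeries.mk fun n => c ^ n

theorem geomSeries_mul_one_sub (c : R) :
    geomSeries c * (1 - PowerSeries.C c * PowerSeries.X) = 1 := by
  ext n
  rw [mul_sub, mul_one, ← mul_assoc, map_sub]
  rcases n with _ | n
  · simp [geomSeries]
  · rw [PowerSeries.coeff_succ_mul_X, PowerSeries.coeff_mul_C]
    simp [geomSeries, pow_succ]

/-- The series `Ω[-uM] = (1 - u) (1 - q t u) / ((1 - t u) (1 - q u))` over a ring of scalars. -/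
def omegaM (q t : R) : PowerSeries R :=
  (1 - PowerSeries.X) * (1 - PowerSeries.C (q * t) * PowerSeries.X) * geomSeries t * geomSeries q

theorem omegaM_mul (q t : R) :
    omegaM q t * ((1 - PowerSeries.C t * PowerSeries.X) * (1 - PowerSeries.C q * PowerSeries.X)) =
      (1 - PowerSeries.X) * (1 - PowerSeries.C (q * t) * PowerSeries.X) := by
  have ht := geomSeries_mul_one_sub t
  have hq := geomSeries_mul_one_sub q
  rw [omegaM]
  generalize geomSeries t = f at *
  generalize geomSeries q = g at *
  linear_combination ((1 - PowerSeries.X) * (1 - PowerSeries.C (q * t) * PowerSeries.X)) *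
    (g * (1 - PowerSeries.C q * PowerSeries.X) * ht + hq)

/-- `f = exp (∑_{k ≥ 1} E_k u^k / k)`, expressed through the differential equation
`f' = (∑_{k ≥ 1} E_k u^(k-1)) f` and `f(0) = 1`. -/
def IsPlethysticExp (E : ℕ+ → R) (f : PowerSeries R) : Prop :=
  constantCoeff f = 1 ∧ derivative R f = (PowerSeries.mk fun n => E n.succPNat) * f

namespace IsPlethysticExp

variable {S : Type*} [CommRing S] {E E' : ℕ+ → R} {f g : PowerSeries R}

theorem coeff_succ (h : IsPlethysticExp E f) (n : ℕ) :
    coeff (n + 1) f * (n + 1) =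
      ∑ x ∈ antidiagonal n, E x.1.succPNat * coeff x.2 f := by
  rw [← PowerSeries.coeff_derivative, h.2, PowerSeries.coeff_mul]
  simp

theorem unique [IsAddTorsionFree R] (hf : IsPlethysticExp E f) (hg : IsPlethysticExp E g) :
    f = g := by
  ext n
  induction n using Nat.strong_induction_on with
  | _ n ih =>
    rcases n with _ | n
    · simpa using hf.1.trans hg.1.symm
    · have key : coeff (n + 1) f * (n + 1) = coeff (n + 1) g * (n + 1) := by
        rw [hf.coeff_succ, hg.coeff_succ]
        refine Finset.sum_congr rfl fun x hx => ?_
        rw [ih x.2 (by have := mem_antidiagonal.mp hx; omega)]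
      have : (n + 1) • coeff (n + 1) f = (n + 1) • coeff (n + 1) g := by
        simpa [nsmul_eq_mul, mul_comm] using key
      exact IsAddTorsionFree.nsmul_right_injective (Nat.succ_ne_zero n) this

theorem mul (hf : IsPlethysticExp E f) (hg : IsPlethysticExp E' g) :
    IsPlethysticExp (fun k => E k + E' k) (f * g) := by
  refine ⟨by simp [hf.1, hg.1], ?_⟩
  have : (PowerSeries.mk fun n => E n.succPNat + E' n.succPNat) =
      (PowerSeries.mk fun n => E n.succPNat) + PowerSeries.mk fun n => E' n.succPNat := by
    ext; simp
  rw [Derivation.leibniz, hf.2, hg.2, this, smul_eq_mul, smul_eq_mul]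
  ring

theorem one : IsPlethysticExp (fun _ => 0) (1 : PowerSeries R) := by
  have : (PowerSeries.mk fun _ => (0 : R)) = 0 := by ext; simp
  refine ⟨by simp, ?_⟩
  rw [this, zero_mul, ← map_one (PowerSeries.C (R := R)), PowerSeries.derivative_C]

theorem prod {ι : Type*} (s : Finset ι) {E : ι → ℕ+ → R} {f : ι → PowerSeries R}
    (h : ∀ i ∈ s, IsPlethysticExp (E i) (f i)) :
    IsPlethysticExp (fun k => ∑ i ∈ s, E i k) (∏ i ∈ s, f i) := by
  classical
  induction s using Finset.induction_on with
  | empty => simpa using one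
  | insert a s ha ih =>
    simp only [Finset.prod_insert ha, Finset.sum_insert ha]
    exact (h a (by simp)).mul (ih fun i hi => h i (by simp [hi]))

theorem map (h : IsPlethysticExp E f) (φ : R →+* S) :
    IsPlethysticExp (fun k => φ (E k)) (PowerSeries.map φ f) := by
  refine ⟨by rw [← coeff_zero_eq_constantCoeff_apply, coeff_map, coeff_zero_eq_constantCoeff_apply,
    h.1, map_one], ?_⟩
  ext n
  simp only [PowerSeries.coeff_derivative, PowerSeries.coeff_mul, coeff_map, coeff_mk, ← map_mul,
    ← map_sum, ← h.coeff_succ]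
  simp

theorem rescale (h : IsPlethysticExp E f) (c : R) :
    IsPlethysticExp (fun k => c ^ (k : ℕ) * E k) (PowerSeries.rescale c f) := by
  refine ⟨by rw [← coeff_zero_eq_constantCoeff_apply, coeff_rescale,
    coeff_zero_eq_constantCoeff_apply, h.1, pow_zero, one_mul], ?_⟩
  ext n
  rw [PowerSeries.coeff_derivative, coeff_rescale, mul_assoc, h.coeff_succ, PowerSeries.coeff_mul,
    Finset.mul_sum]
  refine Finset.sum_congr rfl fun x hx => ?_
  rw [coeff_mk, coeff_rescale, ← mem_antidiagonal.mp hx]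
  simp only [Nat.succPNat_coe, Nat.succ_eq_add_one]
  ring

theorem one_sub (c : R) :
    IsPlethysticExp (fun k => -c ^ (k : ℕ)) (1 - PowerSeries.C c * PowerSeries.X) := by
  refine ⟨by simp, ?_⟩
  have hderiv : derivative R (1 - PowerSeries.C c * PowerSeries.X) = -PowerSeries.C c := by
    rw [map_sub, Derivation.leibniz, PowerSeries.derivative_one]
    simp
  rw [hderiv]
  ext n
  rw [mul_sub, mul_one, ← mul_assoc, map_sub]
  rcases n with _ | n
  · simp
  · rw [PowerSeries.coeff_succ_mul_X, PowerSeries.coeff_mul_C]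
    simp [pow_succ]

theorem geomSeries (c : R) : IsPlethysticExp (fun k => c ^ (k : ℕ)) (geomSeries c) := by
  refine ⟨by rw [← coeff_zero_eq_constantCoeff_apply]; simp [SymFun.geomSeries], ?_⟩
  ext n
  rw [PowerSeries.coeff_derivative, PowerSeries.coeff_mul,
    Finset.sum_congr rfl (g := fun _ => c ^ (n + 1))]
  · simp [SymFun.geomSeries, mul_comm]
  · intro x hx
    rw [← mem_antidiagonal.mp hx]
    simp only [SymFun.geomSeries, coeff_mk, Nat.succPNat_coe, Nat.succ_eq_add_one]
    ring

end IsPlethysticExp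

variable {K : Type*} [Field K] [CharZero K]

theorem isPlethysticExp_Omega (E : ℕ+ → Sym K) : IsPlethysticExp E (Omega E) := by
  set L : PowerSeries (Sym K) :=
    PowerSeries.mk fun k : ℕ => if h : 0 < k then (k : ℚ)⁻¹ • E (k.toPNat h) else 0 with hL
  have hs : HasSubst L := HasSubst.of_constantCoeff_zero' (by
    rw [← coeff_zero_eq_constantCoeff_apply]; simp [hL])
  have hd : derivative (Sym K) L = PowerSeries.mk fun n => E n.succPNat := by
    ext1 n
    rw [PowerSeries.coeff_derivative, hL, coeff_mk, coeff_mk, dif_pos n.succ_pos]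
    have h1 : ((n : Sym K) + 1) = ((n + 1 : ℕ) : ℚ) • (1 : Sym K) := by
      rw [Nat.cast_smul_eq_nsmul, nsmul_one]; push_cast; rfl
    rw [h1, smul_mul_smul_comm, mul_one, inv_mul_cancel₀ (by positivity), one_smul]
    rfl
  refine ⟨?_, ?_⟩
  · have := PowerSeries.constantCoeff_subst (R := Sym K) hs (PowerSeries.exp (Sym K))
    rw [show constantCoeff (Omega E) = MvPowerSeries.constantCoeff
      ((PowerSeries.exp (Sym K)).subst L) from rfl, this, finsum_eq_single _ 0]
    · simp
    · intro n hn
      rw [map_pow]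
      have h0 : MvPowerSeries.constantCoeff L = 0 := by
        change constantCoeff L = 0
        rw [← coeff_zero_eq_constantCoeff_apply]; simp [hL]
      rw [h0, zero_pow hn, smul_zero]
  · have := PowerSeries.derivative_subst (f := PowerSeries.exp (Sym K)) hs
    rw [PowerSeries.derivative_exp, hd] at this
    rw [show Omega E = (PowerSeries.exp (Sym K)).subst L from rfl, this, mul_comm]

theorem OmegaNegX_eq_mk : (OmegaNegX : PowerSeries (Sym K)) =
    PowerSeries.mk fun i => (-1) ^ i * e i := by
  refine (isPlethysticExp_Omega fun k => -p k).unique ?_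
  have h := (isPlethysticExp_Omega (K := K)
    fun k : ℕ+ => (-1) ^ ((k : ℕ) - 1) * p k).rescale (-1)
  convert h using 1
  · funext k
    obtain ⟨n, hn⟩ : ∃ n, (k : ℕ) = n + 1 := ⟨k.natPred, by simp⟩
    rw [hn, Nat.add_sub_cancel, ← mul_assoc, ← pow_add,
      Odd.neg_one_pow (by exact ⟨n, by ring⟩)]
    ring
  · ext1 i
    simp [e]

theorem e_one : (e 1 : Sym K) = p 1 := by
  have h := (isPlethysticExp_Omega (K := K)
    fun k : ℕ+ => (-1) ^ ((k : ℕ) - 1) * p k)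
  have h1 := h.coeff_succ 0
  rw [Nat.cast_zero, zero_add, zero_add, mul_one, HasAntidiagonal.antidiagonal_zero,
    Finset.sum_singleton, coeff_zero_eq_constantCoeff_apply, h.1] at h1
  rw [e, h1]
  simp [Nat.succPNat]

theorem OmegaNegM_eq_map (q t : K) :
    OmegaNegM q t = PowerSeries.map MvPolynomial.C (omegaM q t) := by
  have h := ((((IsPlethysticExp.one_sub (1 : K)).mul (.one_sub (q * t))).mul (.geomSeries t)).mul
    (.geomSeries q)).map (MvPolynomial.C (σ := ℕ+))
  refine (isPlethysticExp_Omega _).unique ?_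
  convert h using 1
  · funext k
    rw [← map_neg, pM]
    congr 1
    ring
  · rw [omegaM, map_one, one_mul]

end PlethysticExp

section Transport

open HahnSeries

instance hahnSeries_isAddTorsionFree {Γ R : Type*} [PartialOrder Γ] [AddCommMonoid R]
    [IsAddTorsionFree R] : IsAddTorsionFree (HahnSeries Γ R) where
  nsmul_right_injective n hn x y h := by
    ext a
    have hcoeff := congrArg (fun z => HahnSeries.coeff z a) h
    simp only [HahnSeries.coeff_smul] at hcoeff
    exact IsAddTorsionFree.nsmul_right_injective hn hcoeff

section Evaluation

variable {Γ R : Type*} [AddCommGroup Γ] [LinearOrder Γ] [IsOrderedAddMonoid Γ] [CommRing R]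

theorem coeff_heval_single {v : Γ} (hv : 0 < v) (f : PowerSeries R) (n : ℕ) :
    (PowerSeries.heval (single v (1 : R)) f).coeff (n • v) = PowerSeries.coeff n f := by
  rcases subsingleton_or_nontrivial R with h | h
  · exact Subsingleton.elim _ _
  rw [PowerSeries.coeff_heval, finsum_eq_single _ n]
  · simp [hv]
  · intro k hk
    have : n • v ≠ k • v := fun h => hk ((nsmul_left_strictMono hv).injective h.symm)
    simp [hv, coeff_single_of_ne this]

theorem coeff_heval_single_of_ne {v : Γ} (hv : 0 < v) (f : PowerSeries R) {a : Γ}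
    (ha : ∀ n : ℕ, a ≠ n • v) :
    (PowerSeries.heval (single v (1 : R)) f).coeff a = 0 := by
  rcases subsingleton_or_nontrivial R with h | h
  · exact Subsingleton.elim _ _
  rw [PowerSeries.coeff_heval, finsum_eq_zero_of_forall_eq_zero]
  intro k
  simp [hv, coeff_single_of_ne (ha k)]

end Evaluation

section MapRingHom

variable {Γ A B : Type*} [AddCommMonoid Γ] [PartialOrder Γ] [IsOrderedCancelAddMonoid Γ]
  [CommRing A] [CommRing B]

/-- The ring homomorphism of Hahn series which applies a ring homomorphism to the coefficients. -/
def hahnMap (φ : A →+* B) : HahnSeries Γ A →+* HahnSeries Γ B where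
  toFun x := x.map φ
  map_one' := HahnSeries.map_C 1 φ |>.trans (by simp)
  map_zero' := by ext; simp
  map_add' x y := by ext; simp
  map_mul' x y := HahnSeries.map_mul (φ : A →ₙ+* B)

theorem coeff_hahnMap (φ : A →+* B) (x : HahnSeries Γ A) (a : Γ) :
    (hahnMap φ x).coeff a = φ (x.coeff a) := rfl

theorem hahnMap_single (φ : A →+* B) (a : Γ) (r : A) :
    hahnMap φ (single a r) = single a (φ r) := by
  ext b
  rw [coeff_hahnMap, coeff_single, coeff_single]
  split_ifs <;> simp

end MapRingHom

theorem hahnMap_heval {Γ A B : Type*} [AddCommGroup Γ] [LinearOrder Γ] [IsOrderedAddMonoid Γ]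
    [CommRing A] [CommRing B] (φ : A →+* B) {v : Γ} (hv : 0 < v) (f : PowerSeries A) :
    hahnMap φ (PowerSeries.heval (single v (1 : A)) f) =
      PowerSeries.heval (single v (1 : B)) (PowerSeries.map φ f) := by
  ext a
  rw [coeff_hahnMap]
  by_cases h : ∃ n : ℕ, a = n • v
  · obtain ⟨n, rfl⟩ := h
    rw [coeff_heval_single hv, coeff_heval_single hv, PowerSeries.coeff_map]
  · push Not at h
    rw [coeff_heval_single_of_ne hv _ h, coeff_heval_single_of_ne hv _ h, map_zero]

section Reindex

variable {Γ Γ' R : Type*} [AddCommMonoid Γ] [PartialOrder Γ] [AddCommMonoid Γ'] [PartialOrder Γ']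
  [CommRing R] {e : Γ ≃+ Γ'} {x x' : HahnSeries Γ R} {y y' : HahnSeries Γ' R}

/-- The Hahn series `y` is obtained from `x` by the isomorphism `e` of exponent monoids, which need
not be monotone. -/
def IsReindex (e : Γ ≃+ Γ') (x : HahnSeries Γ R) (y : HahnSeries Γ' R) : Prop :=
  ∀ a, y.coeff (e a) = x.coeff a

namespace IsReindex

theorem add (h : IsReindex e x y) (h' : IsReindex e x' y') : IsReindex e (x + x') (y + y') :=
  fun a => by simp [h a, h' a]

theorem sub (h : IsReindex e x y) (h' : IsReindex e x' y') : IsReindex e (x - x') (y - y') :=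
  fun a => by simp [h a, h' a]

theorem add_neg (h : IsReindex e x (-y)) (h' : IsReindex e x' (-y')) :
    IsReindex e (x + x') (-(y + y')) :=
  fun a => by simp [← h a, ← h' a, add_comm]

theorem single (a : Γ) (r : R) :
    IsReindex e (HahnSeries.single a r) (HahnSeries.single (e a) r) := by
  intro b
  classical
  rw [coeff_single, coeff_single]
  simp only [EmbeddingLike.apply_eq_iff_eq]

theorem sum {ι : Type*} (s : Finset ι) {f : ι → HahnSeries Γ R} {g : ι → HahnSeries Γ' R}
    (h : ∀ i ∈ s, IsReindex e (f i) (g i)) : IsReindex e (∑ i ∈ s, f i) (∑ i ∈ s, g i) := by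
  intro a
  simp only [coeff_sum]
  exact Finset.sum_congr rfl fun i hi => h i hi a

theorem coeff_zero (h : IsReindex e x y) : y.coeff 0 = x.coeff 0 := by
  have := h 0
  rwa [map_zero] at this

theorem coeff_zero_of_neg [IsAddTorsionFree R] {e : Γ ≃+ Γ} (h : IsReindex e x (-x)) :
    x.coeff 0 = 0 := by
  have := h.coeff_zero
  rw [coeff_neg] at this
  exact self_eq_neg.mp this.symm

variable [IsOrderedCancelAddMonoid Γ] [IsOrderedCancelAddMonoid Γ']

theorem C (r : R) : IsReindex e (HahnSeries.C r) (HahnSeries.C r) := by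
  have := single (e := e) 0 r
  rwa [map_zero] at this

theorem mul (h : IsReindex e x y) (h' : IsReindex e x' y') : IsReindex e (x * x') (y * y') := by
  intro a
  rw [coeff_mul, coeff_mul]
  symm
  refine Finset.sum_bij' (fun i _ => (e i.1, e i.2)) (fun i _ => (e.symm i.1, e.symm i.2))
    ?_ ?_ ?_ ?_ ?_
  · intro i hi
    simp only [Finset.mem_antidiagonal, mem_support] at hi ⊢
    rw [h, h', ← map_add, hi.2.2]
    exact ⟨hi.1, hi.2.1, rfl⟩
  · intro i hi
    simp only [Finset.mem_antidiagonal, mem_support] at hi ⊢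
    rw [← h, ← h', ← map_add, hi.2.2, e.apply_symm_apply, e.apply_symm_apply, e.symm_apply_apply]
    exact ⟨hi.1, hi.2.1, rfl⟩
  · simp
  · simp
  · intro i _
    rw [h, h']

theorem mul_neg (h : IsReindex e x y) (h' : IsReindex e x' (-y')) :
    IsReindex e (x * x') (-(y * y')) :=
  neg_mul_eq_mul_neg y y' ▸ h.mul h'

theorem prod {ι : Type*} (s : Finset ι) {f : ι → HahnSeries Γ R} {g : ι → HahnSeries Γ' R}
    (h : ∀ i ∈ s, IsReindex e (f i) (g i)) : IsReindex e (∏ i ∈ s, f i) (∏ i ∈ s, g i) := by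
  classical
  induction s using Finset.induction_on with
  | empty => simpa using C (e := e) (1 : R)
  | insert a s ha ih =>
    simp only [Finset.prod_insert ha]
    exact (h a (by simp)).mul (ih fun i hi => h i (by simp [hi]))

end IsReindex

theorem IsReindex.heval {Γ Γ' R : Type*} [AddCommGroup Γ] [LinearOrder Γ] [IsOrderedAddMonoid Γ]
    [AddCommGroup Γ'] [LinearOrder Γ'] [IsOrderedAddMonoid Γ'] [CommRing R] {e : Γ ≃+ Γ'}
    {v : Γ} (hv : 0 < v) (hev : 0 < e v) (f : PowerSeries R) :
    IsReindex e (PowerSeries.heval (HahnSeries.single v (1 : R)) f)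
      (PowerSeries.heval (HahnSeries.single (e v) (1 : R)) f) := by
  intro a
  by_cases h : ∃ n : ℕ, a = n • v
  · obtain ⟨n, rfl⟩ := h
    rw [map_nsmul, coeff_heval_single hv, coeff_heval_single hev]
  · push Not at h
    rw [coeff_heval_single_of_ne hv _ h, coeff_heval_single_of_ne hev]
    intro n hn
    rw [← map_nsmul] at hn
    exact h n (e.injective hn)

end Reindex

section Iterate

variable {Γ₁ Γ₂ Γ R : Type*} [AddCommMonoid Γ₁] [PartialOrder Γ₁] [AddCommMonoid Γ₂]
  [PartialOrder Γ₂] [AddCommMonoid Γ] [PartialOrder Γ] [CommRing R] {e : Γ₁ × Γ₂ ≃+ Γ}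
  {x x' : HahnSeries Γ₁ (HahnSeries Γ₂ R)} {y y' : HahnSeries Γ R}

/-- The iterated Hahn series `x` and the Hahn series `y` agree, exponents being identified
by `e`. -/
def IsIterate (e : Γ₁ × Γ₂ ≃+ Γ) (x : HahnSeries Γ₁ (HahnSeries Γ₂ R)) (y : HahnSeries Γ R) :
    Prop :=
  ∀ k l, y.coeff (e (k, l)) = (x.coeff k).coeff l

namespace IsIterate

theorem add (h : IsIterate e x y) (h' : IsIterate e x' y') : IsIterate e (x + x') (y + y') :=
  fun k l => by simp [h k l, h' k l]

theorem single (a : Γ₁) (b : Γ₂) (r : R) :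
    IsIterate e (HahnSeries.single a (HahnSeries.single b r)) (HahnSeries.single (e (a, b)) r) := by
  intro k l
  classical
  rw [coeff_single, coeff_single]
  simp only [EmbeddingLike.apply_eq_iff_eq, Prod.mk.injEq]
  by_cases hk : k = a
  · simp [hk, coeff_single]
  · simp [hk]

theorem sum {ι : Type*} (s : Finset ι) {f : ι → HahnSeries Γ₁ (HahnSeries Γ₂ R)}
    {g : ι → HahnSeries Γ R} (h : ∀ i ∈ s, IsIterate e (f i) (g i)) :
    IsIterate e (∑ i ∈ s, f i) (∑ i ∈ s, g i) := by
  intro k l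
  simp only [coeff_sum]
  exact Finset.sum_congr rfl fun i hi => h i hi k l

theorem coeff_zero (h : IsIterate e x y) : y.coeff 0 = (x.coeff 0).coeff 0 := by
  have := h 0 0
  rwa [show ((0, 0) : Γ₁ × Γ₂) = 0 from rfl, map_zero] at this

variable [IsOrderedCancelAddMonoid Γ₁] [IsOrderedCancelAddMonoid Γ₂] [IsOrderedCancelAddMonoid Γ]

theorem C (r : R) : IsIterate e (HahnSeries.C (HahnSeries.C r)) (HahnSeries.C r) := by
  have := single (e := e) 0 0 r
  rwa [show ((0, 0) : Γ₁ × Γ₂) = 0 from rfl, map_zero] at this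

theorem mul (h : IsIterate e x y) (h' : IsIterate e x' y') : IsIterate e (x * x') (y * y') := by
  intro k l
  rw [coeff_mul, coeff_mul, coeff_sum]
  simp only [coeff_mul]
  rw [Finset.sum_sigma']
  symm
  refine Finset.sum_bij' (fun i _ => (e (i.1.1, i.2.1), e (i.1.2, i.2.2)))
    (fun i _ => ⟨((e.symm i.1).1, (e.symm i.2).1), ((e.symm i.1).2, (e.symm i.2).2)⟩)
    ?_ ?_ ?_ ?_ ?_
  · intro i hi
    simp only [Finset.mem_sigma, Finset.mem_antidiagonal, mem_support] at hi ⊢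
    obtain ⟨⟨_, _, h3⟩, h4, h5, h6⟩ := hi
    refine ⟨by rwa [h], by rwa [h'], ?_⟩
    rw [← map_add, Prod.mk_add_mk, h3, h6]
  · intro i hi
    simp only [Finset.mem_antidiagonal, mem_support] at hi
    obtain ⟨h1, h2, h3⟩ := hi
    rw [← e.apply_symm_apply i.1, ← Prod.mk.eta (p := e.symm i.1), h] at h1
    rw [← e.apply_symm_apply i.2, ← Prod.mk.eta (p := e.symm i.2), h'] at h2
    have h4 : e.symm i.1 + e.symm i.2 = (k, l) := by
      rw [← map_add, h3, e.symm_apply_apply]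
    simp only [Finset.mem_sigma, Finset.mem_antidiagonal, mem_support]
    exact ⟨⟨fun h0 => h1 (by rw [h0, HahnSeries.coeff_zero]),
      fun h0 => h2 (by rw [h0, HahnSeries.coeff_zero]), congrArg Prod.fst h4⟩,
      h1, h2, congrArg Prod.snd h4⟩
  · simp
  · simp
  · intro i _
    rw [h, h']

theorem prod {ι : Type*} (s : Finset ι) {f : ι → HahnSeries Γ₁ (HahnSeries Γ₂ R)}
    {g : ι → HahnSeries Γ R} (h : ∀ i ∈ s, IsIterate e (f i) (g i)) :
    IsIterate e (∏ i ∈ s, f i) (∏ i ∈ s, g i) := by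
  classical
  induction s using Finset.induction_on with
  | empty => simpa using C (e := e) (1 : R)
  | insert a s ha ih =>
    simp only [Finset.prod_insert ha]
    exact (h a (by simp)).mul (ih fun i hi => h i (by simp [hi]))

theorem coeff_zero_hahnMap_mul_C {A : Type*} [CommRing A] {φ : A →+* HahnSeries Γ₂ R}
    {f : HahnSeries Γ₁ A} {g : HahnSeries Γ₂ R} (h : IsIterate e (hahnMap φ f) y)
    (h' : IsIterate e (HahnSeries.C g) y') : (φ (f.coeff 0) * g).coeff 0 = (y * y').coeff 0 := by
  rw [(h.mul h').coeff_zero, HahnSeries.C_apply, HahnSeries.coeff_mul_single_zero, coeff_hahnMap]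

end IsIterate

end Iterate

section IterateEvaluation

variable {Γ₁ Γ₂ Γ R : Type*} [AddCommGroup Γ₁] [LinearOrder Γ₁] [IsOrderedAddMonoid Γ₁]
  [AddCommGroup Γ₂] [LinearOrder Γ₂] [IsOrderedAddMonoid Γ₂]
  [AddCommGroup Γ] [LinearOrder Γ] [IsOrderedAddMonoid Γ] [CommRing R]
  {e : Γ₁ × Γ₂ ≃+ Γ}

theorem IsIterate.heval_rescale {v : Γ₁} {w : Γ₂} (hv : 0 < v) (he : 0 < e (v, w))
    (f : PowerSeries R) :
    IsIterate e
      (PowerSeries.heval (HahnSeries.single v (1 : HahnSeries Γ₂ R))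
        (PowerSeries.rescale (HahnSeries.single w (1 : R)) (PowerSeries.map HahnSeries.C f)))
      (PowerSeries.heval (HahnSeries.single (e (v, w)) (1 : R)) f) := by
  intro k l
  by_cases h : ∃ n : ℕ, k = n • v
  · obtain ⟨n, rfl⟩ := h
    rw [coeff_heval_single hv, PowerSeries.coeff_rescale, PowerSeries.coeff_map, single_pow,
      HahnSeries.C_apply, single_mul_single, add_zero, one_pow, one_mul, coeff_single]
    split_ifs with hl
    · rw [hl, show (n • v, n • w) = n • (v, w) from rfl, map_nsmul, coeff_heval_single he]
    · refine coeff_heval_single_of_ne he _ fun n' hn' => ?_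
      rw [← map_nsmul] at hn'
      have h1 := e.injective hn'
      have h2 : n = n' := (nsmul_left_strictMono hv).injective (congrArg Prod.fst h1)
      exact hl (by rw [h2]; exact congrArg Prod.snd h1)
  · push Not at h
    rw [coeff_heval_single_of_ne hv _ h, HahnSeries.coeff_zero]
    refine coeff_heval_single_of_ne he _ fun n' hn' => ?_
    rw [← map_nsmul] at hn'
    exact h n' (congrArg Prod.fst (e.injective hn'))

theorem IsIterate.heval_left {v : Γ₁} (hv : 0 < v) (he : 0 < e (v, 0)) (f : PowerSeries R) :
    IsIterate e
      (PowerSeries.heval (HahnSeries.single v (1 : HahnSeries Γ₂ R))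
        (PowerSeries.map HahnSeries.C f))
      (PowerSeries.heval (HahnSeries.single (e (v, 0)) (1 : R)) f) := by
  have := IsIterate.heval_rescale hv he f
  rwa [show HahnSeries.single (0 : Γ₂) (1 : R) = 1 from rfl, PowerSeries.rescale_one] at this

theorem IsIterate.heval_right {w : Γ₂} (hw : 0 < w) (he : 0 < e (0, w)) (f : PowerSeries R) :
    IsIterate e
      (HahnSeries.C (PowerSeries.heval (HahnSeries.single w (1 : R)) f))
      (PowerSeries.heval (HahnSeries.single (e (0, w)) (1 : R)) f) := by
  intro k l
  rw [HahnSeries.C_apply, coeff_single]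
  split_ifs with hk
  · subst hk
    by_cases h : ∃ n : ℕ, l = n • w
    · obtain ⟨n, rfl⟩ := h
      rw [show ((0 : Γ₁), n • w) = n • (0, w) by simp, map_nsmul, coeff_heval_single he,
        coeff_heval_single hw]
    · push Not at h
      rw [coeff_heval_single_of_ne hw _ h]
      refine coeff_heval_single_of_ne he _ fun n hn => ?_
      rw [← map_nsmul] at hn
      exact h n (congrArg Prod.snd (e.injective hn))
  · refine coeff_heval_single_of_ne he _ fun n hn => ?_
    rw [← map_nsmul] at hn
    exact hk (by simpa using congrArg Prod.fst (e.injective hn))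

end IterateEvaluation

end Transport

section Exponents

/-- Concatenation of exponent vectors. -/
def appendAddEquiv {m₁ m₂ m : ℕ} (h : m₁ + m₂ = m) :
    Lex (Fin m₁ → ℤ) × Lex (Fin m₂ → ℤ) ≃+ Lex (Fin m → ℤ) where
  toFun x := toLex fun i => Fin.append (ofLex x.1) (ofLex x.2) (i.cast h.symm)
  invFun x := (toLex fun i => ofLex x ((i.castAdd m₂).cast h),
    toLex fun j => ofLex x ((j.natAdd m₁).cast h))
  left_inv x := Prod.ext (ofLex.injective (funext fun i => by simp))
    (ofLex.injective (funext fun i => by simp))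
  right_inv x := by
    subst h
    apply ofLex.injective
    funext i
    refine Fin.addCases (fun i => ?_) (fun i => ?_) i <;> simp
  map_add' x y := by
    subst h
    apply ofLex.injective
    funext i
    refine Fin.addCases (fun i => ?_) (fun i => ?_) i <;>
      simp only [ofLex_add, ofLex_toLex, Pi.add_apply, Fin.cast_eq_self, Fin.append_left,
        Fin.append_right, Prod.fst_add, Prod.snd_add]

section Append

variable {m₁ m₂ m : ℕ} (h : m₁ + m₂ = m)

theorem appendAddEquiv_single_left (i : Fin m₁) (c : ℤ) :
    appendAddEquiv h (toLex (Pi.single i c), 0) =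
      toLex (Pi.single ((i.castAdd m₂).cast h) c) := by
  rw [← AddEquiv.eq_symm_apply]
  refine Prod.ext (ofLex.injective (funext fun j => ?_)) (ofLex.injective (funext fun j => ?_))
  · simp [appendAddEquiv, Pi.single_apply]
  · change (0 : ℤ) = (Pi.single ((i.castAdd m₂).cast h) c : Fin m → ℤ) ((j.natAdd m₁).cast h)
    have hne : m₁ + (j : ℕ) ≠ i := by omega
    simp [Fin.ext_iff, hne]

theorem appendAddEquiv_single_right (j : Fin m₂) (c : ℤ) :
    appendAddEquiv h (0, toLex (Pi.single j c)) =
      toLex (Pi.single ((j.natAdd m₁).cast h) c) := by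
  rw [← AddEquiv.eq_symm_apply]
  refine Prod.ext (ofLex.injective (funext fun i => ?_)) (ofLex.injective (funext fun i => ?_))
  · change (0 : ℤ) = (Pi.single ((j.natAdd m₁).cast h) c : Fin m → ℤ) ((i.castAdd m₂).cast h)
    have hne : (i : ℕ) ≠ m₁ + j := by omega
    simp [Fin.ext_iff, hne]
  · simp [appendAddEquiv, Pi.single_apply]

theorem appendAddEquiv_const (c : ℤ) :
    appendAddEquiv h (toLex fun _ => c, toLex fun _ => c) = toLex fun _ => c := by
  rw [← AddEquiv.eq_symm_apply]
  rfl

theorem appendAddEquiv_pos_left {a : Lex (Fin m₁ → ℤ)} (ha : 0 < a) (b : Lex (Fin m₂ → ℤ)) :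
    0 < appendAddEquiv h (a, b) := by
  subst h
  obtain ⟨i, heq, hlt⟩ := ha
  refine ⟨i.castAdd m₂, fun j => Fin.addCases (fun j hj => ?_) (fun j hj => ?_) j,
    hlt.trans_eq (Fin.append_left (ofLex a) (ofLex b) i).symm⟩
  · exact (heq j hj).trans (Fin.append_left (ofLex a) (ofLex b) j).symm
  · exact absurd hj (by simp [Fin.lt_def, i.is_lt.le.trans])

theorem appendAddEquiv_pos_right {b : Lex (Fin m₂ → ℤ)} (hb : 0 < b) :
    0 < appendAddEquiv h (0, b) := by
  subst h
  obtain ⟨i, heq, hlt⟩ := hb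
  refine ⟨i.natAdd m₁, fun j => Fin.addCases (fun j _ => ?_) (fun j hj => ?_) j,
    hlt.trans_eq (Fin.append_right (0 : Fin m₁ → ℤ) (ofLex b) i).symm⟩
  · exact (Fin.append_left (0 : Fin m₁ → ℤ) (ofLex b) j).symm
  · exact (heq j (by simpa using hj)).trans (Fin.append_right (0 : Fin m₁ → ℤ) (ofLex b) j).symm

@[to_additive]
theorem prod_append {M : Type*} [CommMonoid M] (f : Fin m → M) :
    ∏ i, f i = (∏ i : Fin m₁, f ((i.castAdd m₂).cast h)) *
      ∏ j : Fin m₂, f ((j.natAdd m₁).cast h) := by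
  subst h
  exact Fin.prod_univ_add f

theorem prod_lt_append {M : Type*} [CommMonoid M] (f : Fin m → Fin m → M) :
    ∏ x : Fin m × Fin m with x.1 < x.2, f x.1 x.2 =
      (∏ x : Fin m₁ × Fin m₁ with x.1 < x.2,
        f ((x.1.castAdd m₂).cast h) ((x.2.castAdd m₂).cast h)) *
      (∏ i : Fin m₁, ∏ j : Fin m₂, f ((i.castAdd m₂).cast h) ((j.natAdd m₁).cast h)) *
      ∏ x : Fin m₂ × Fin m₂ with x.1 < x.2,
        f ((x.1.natAdd m₁).cast h) ((x.2.natAdd m₁).cast h) := by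
  subst h
  have left_lt_right (i : Fin m₁) (j : Fin m₂) : i.castAdd m₂ < j.natAdd m₁ := by
    simp [Fin.lt_def, i.is_lt.trans_le]
  have not_right_lt_left (i : Fin m₁) (j : Fin m₂) : ¬ j.natAdd m₁ < i.castAdd m₂ :=
    (left_lt_right i j).le.not_gt
  simp only [Finset.prod_filter, Fintype.prod_prod_type, Fin.prod_univ_add,
    Finset.prod_mul_distrib, Fin.cast_eq_self, left_lt_right, not_right_lt_left, if_true, if_false,
    Finset.prod_const_one, mul_one, mul_assoc, Fin.natAdd_lt_natAdd_iff,
    (Fin.strictMono_castAdd m₂).lt_iff_lt]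

end Append

section Perm

variable {m : ℕ} (σ : Equiv.Perm (Fin m))

/-- Permutation of the entries of exponent vectors. -/
def permAddEquiv : Lex (Fin m → ℤ) ≃+ Lex (Fin m → ℤ) where
  toFun x := toLex fun i => ofLex x (σ.symm i)
  invFun x := toLex fun i => ofLex x (σ i)
  left_inv x := ofLex.injective (funext fun i => congrArg (ofLex x) (σ.symm_apply_apply i))
  right_inv x := ofLex.injective (funext fun i => congrArg (ofLex x) (σ.apply_symm_apply i))
  map_add' _ _ := rfl

theorem permAddEquiv_single (i : Fin m) (c : ℤ) :
    permAddEquiv σ (toLex (Pi.single i c)) = toLex (Pi.single (σ i) c) := by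
  apply ofLex.injective
  funext j
  simp [permAddEquiv, Pi.single_apply, Equiv.symm_apply_eq]

theorem permAddEquiv_const (c : ℤ) :
    permAddEquiv σ (toLex fun _ => c) = toLex fun _ => c := rfl

end Perm

/-- The exponent vectors of `z_1, …, z_m`. -/
def forward (m : ℕ) (i : Fin m) : Lex (Fin m → ℤ) := toLex (Pi.single i 1)

theorem forward_pos {m : ℕ} (i : Fin m) : 0 < forward m i := by
  refine ⟨i, fun j hj => ?_, ?_⟩
  · exact (Pi.single_eq_of_ne (M := fun _ => ℤ) hj.ne 1).symm
  · exact zero_lt_one.trans_eq (Pi.single_eq_same (M := fun _ => ℤ) i 1).symm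

/-- The exponent vectors of `1 / z_m, …, 1 / z_1`. -/
def backward (m : ℕ) (i : Fin m) : Lex (Fin m → ℤ) := toLex (Pi.single i.rev (-1))

theorem backward_eq_neg_forward_rev {m : ℕ} (i : Fin m) : backward m i = -forward m i.rev := by
  rw [backward, Pi.single_neg, toLex_neg, forward]

theorem strictAnti_forward (m : ℕ) : StrictAnti (forward m) := by
  intro i j hij
  refine ⟨i, fun k hk => ?_, ?_⟩
  · simp [forward, hk.ne, (hk.trans hij).ne]
  · simp [forward, hij.ne]

theorem strictAnti_backward (m : ℕ) : StrictAnti (backward m) := by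
  intro i j hij
  rw [backward_eq_neg_forward_rev, backward_eq_neg_forward_rev, neg_lt_neg_iff]
  exact strictAnti_forward m (Fin.rev_lt_rev.mpr hij)

end Exponents

section VertexOperators

variable {K : Type*} [Field K]

section Monomials

variable {Γ : Type*} [AddCommGroup Γ] [LinearOrder Γ] [IsOrderedAddMonoid Γ]

/-- The monomial `z^v`. -/
def zPow (v : Γ) : HahnSeries Γ (Sym K) := HahnSeries.single v 1

theorem zPow_add (v w : Γ) : (zPow (v + w) : HahnSeries Γ (Sym K)) = zPow v * zPow w := by
  simp [zPow]

theorem zPow_nsmul (n : ℕ) (v : Γ) : (zPow (n • v) : HahnSeries Γ (Sym K)) = zPow v ^ n := by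
  simp [zPow]

/-- The series `f(z^v)`, for a power series `f` with scalar coefficients and `0 < v`. -/
def scalarEval (v : Γ) : PowerSeries K →+* HahnSeries Γ (Sym K) :=
  (PowerSeries.heval (zPow v)).toRingHom.comp (PowerSeries.map MvPolynomial.C)

theorem scalarEval_apply (v : Γ) (f : PowerSeries K) :
    scalarEval v f = PowerSeries.heval (zPow v) (PowerSeries.map MvPolynomial.C f) := rfl

/-- The constant series with value the scalar `c`. -/
def scalar : K →+* HahnSeries Γ (Sym K) := HahnSeries.C.comp MvPolynomial.C

theorem smul_eq_scalar_mul (c : K) (x : HahnSeries Γ (Sym K)) : c • x = scalar c * x := by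
  ext a : 2
  rw [scalar, RingHom.comp_apply, HahnSeries.C_mul_eq_smul, HahnSeries.coeff_smul,
    HahnSeries.coeff_smul, smul_eq_mul, MvPolynomial.smul_eq_C_mul]

theorem scalarEval_C (v : Γ) (c : K) : scalarEval v (PowerSeries.C c) = scalar c := by
  rw [scalarEval_apply, PowerSeries.map_C, PowerSeries.heval_C, ← HahnSeries.C_mul_eq_smul, mul_one]
  rfl

theorem scalarEval_X {v : Γ} (hv : 0 < v) :
    (scalarEval v PowerSeries.X : HahnSeries Γ (Sym K)) = zPow v := by
  rw [scalarEval_apply, PowerSeries.map_X, PowerSeries.heval_X]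
  rw [zPow, HahnSeries.orderTop_single one_ne_zero]
  exact_mod_cast hv

end Monomials

section Shift

variable {Γ Γ' : Type*} [AddCommMonoid Γ] [PartialOrder Γ] [IsOrderedCancelAddMonoid Γ]
  [AddCommMonoid Γ'] [PartialOrder Γ'] [IsOrderedCancelAddMonoid Γ']

theorem shift_C (E : ℕ+ → HahnSeries Γ (Sym K)) (c : K) :
    shift E (MvPolynomial.C c) = HahnSeries.C (MvPolynomial.C c) := by
  simp [shift]

theorem shift_p (E : ℕ+ → HahnSeries Γ (Sym K)) (k : ℕ+) :
    shift E (p k) = HahnSeries.C (p k) + E k := by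
  simp [shift, p]

theorem isReindex_shift {e : Γ ≃+ Γ'} {E : ℕ+ → HahnSeries Γ (Sym K)}
    {E' : ℕ+ → HahnSeries Γ' (Sym K)} (h : ∀ k, IsReindex e (E k) (E' k)) (F : Sym K) :
    IsReindex e (shift E F) (shift E' F) := by
  induction F using MvPolynomial.induction_on with
  | C c =>
    rw [shift_C, shift_C]
    exact IsReindex.C _
  | add F G hF hG =>
    simp only [map_add]
    exact hF.add hG
  | mul_X F k hF =>
    rw [map_mul, map_mul, ← p, shift_p, shift_p]
    exact hF.mul ((IsReindex.C _).add (h k))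

theorem isIterate_shift {Γ₁ Γ₂ : Type*} [AddCommMonoid Γ₁] [PartialOrder Γ₁]
    [IsOrderedCancelAddMonoid Γ₁] [AddCommMonoid Γ₂] [PartialOrder Γ₂]
    [IsOrderedCancelAddMonoid Γ₂] {e : Γ₁ × Γ₂ ≃+ Γ} {E₁ : ℕ+ → HahnSeries Γ₁ (Sym K)}
    {E₂ : ℕ+ → HahnSeries Γ₂ (Sym K)} {E : ℕ+ → HahnSeries Γ (Sym K)}
    (h : ∀ k, IsIterate e (HahnSeries.C (E₂ k) + hahnMap (shift E₂) (E₁ k)) (E k)) (F : Sym K) :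
    IsIterate e (hahnMap (shift E₂) (shift E₁ F)) (shift E F) := by
  induction F using MvPolynomial.induction_on with
  | C c =>
    rw [shift_C, shift_C, HahnSeries.C_apply, hahnMap_single, shift_C]
    exact IsIterate.C _
  | add F G hF hG =>
    simp only [map_add]
    exact hF.add hG
  | mul_X F k hF =>
    rw [map_mul, map_mul, map_mul, ← p, shift_p, shift_p, map_add, HahnSeries.C_apply,
      hahnMap_single, shift_p, ← HahnSeries.C_apply, map_add, add_assoc]
    exact hF.mul ((IsIterate.C _).add (h k))

end Shift

section Definitions

variable {m : ℕ}

/-- The substitution `F[X] ↦ F[X + ∑_i M / z_i]`. -/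
def shiftAll (q t : K) (m : ℕ) : Sym K →+* Series K m :=
  shift fun k : ℕ+ => ∑ i, HahnSeries.single ((k : ℕ) • -forward m i) (MvPolynomial.C (pM q t k))

/-- The product `∏_{i<j} Ω[-M z_i/z_j]`. -/
def interaction (q t : K) (m : ℕ) : Series K m :=
  ∏ x : Fin m × Fin m with x.1 < x.2, scalarEval (forward m x.1 - forward m x.2) (omegaM q t)

variable [CharZero K]

/-- The product `∏_i Ω[-z_i X]`. -/
def omegaSeries (m : ℕ) : Series K m := ∏ i, PowerSeries.heval (zPow (forward m i)) OmegaNegX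

/-- The operator which sends `F` to the constant term of
`F[X + ∑_i M/z_i] ∏_i Ω[-z_i X] x(z)`. -/
def vertexOp (q t : K) (m : ℕ) : Series K m →ₗ[K] Module.End K (Sym K) :=
  LinearMap.mk₂ K (fun x F => (shiftAll q t m F * omegaSeries m * x).coeff 0)
    (fun x y F => by rw [mul_add, HahnSeries.coeff_add])
    (fun c x F => by rw [mul_smul_comm, HahnSeries.coeff_smul])
    (fun x F G => by rw [map_add, add_mul, add_mul, HahnSeries.coeff_add])
    (fun c x F => by
      rw [shiftAll, shift_smul, mul_assoc, mul_assoc, HahnSeries.C_mul_eq_smul,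
        HahnSeries.coeff_smul, smul_eq_mul, MvPolynomial.smul_eq_C_mul, mul_assoc])

theorem vertexOp_apply (q t : K) (x : Series K m) (F : Sym K) :
    vertexOp q t m x F = (shiftAll q t m F * omegaSeries m * x).coeff 0 := rfl

/-- The operator with kernel `g`: it sends `F` to the constant term of
`F[X + ∑_i M/z_i] ∏_i Ω[-z_i X] g(z) ∏_{i<j} Ω[-M z_i/z_j]`. -/
def kernelOp (q t : K) (g : Series K m) : Module.End K (Sym K) :=
  vertexOp q t m (g * interaction q t m)

end Definitions

section Transport

section Iterate

variable {Γ₁ Γ₂ Γ : Type*} [AddCommGroup Γ₁] [LinearOrder Γ₁] [IsOrderedAddMonoid Γ₁]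
  [AddCommGroup Γ₂] [LinearOrder Γ₂] [IsOrderedAddMonoid Γ₂] [AddCommGroup Γ] [LinearOrder Γ]
  {e : Γ₁ × Γ₂ ≃+ Γ}

theorem isIterate_single_left (E : ℕ+ → HahnSeries Γ₂ (Sym K)) (v : Γ₁) (c : K) :
    IsIterate e (hahnMap (shift E) (HahnSeries.single v (MvPolynomial.C c)))
      (HahnSeries.single (e (v, 0)) (MvPolynomial.C c)) := by
  rw [hahnMap_single, shift_C]
  exact IsIterate.single v 0 _

theorem isIterate_zPow_left (E : ℕ+ → HahnSeries Γ₂ (Sym K)) (v : Γ₁) :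
    IsIterate e (hahnMap (shift E) (zPow v)) (zPow (e (v, 0))) := by
  have h := isIterate_single_left (e := e) E v (1 : K)
  rwa [map_one] at h

theorem isIterate_zPow_right (w : Γ₂) :
    IsIterate e (HahnSeries.C (zPow w : HahnSeries Γ₂ (Sym K))) (zPow (e (0, w))) :=
  IsIterate.single 0 w 1

variable [IsOrderedAddMonoid Γ]

theorem isIterate_scalarEval_left (E : ℕ+ → HahnSeries Γ₂ (Sym K)) {v : Γ₁} (hv : 0 < v)
    (hev : 0 < e (v, 0)) (f : PowerSeries K) :
    IsIterate e (hahnMap (shift E) (scalarEval v f)) (scalarEval (e (v, 0)) f) := by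
  have hf : PowerSeries.map (shift E) (PowerSeries.map MvPolynomial.C f) =
      PowerSeries.map HahnSeries.C (PowerSeries.map MvPolynomial.C f) := by
    ext1 n
    simp only [PowerSeries.coeff_map, shift_C]
  rw [scalarEval_apply, zPow, hahnMap_heval _ hv, hf]
  exact IsIterate.heval_left hv hev _

theorem isIterate_scalarEval_right {w : Γ₂} (hw : 0 < w) (hew : 0 < e (0, w))
    (f : PowerSeries K) :
    IsIterate e (HahnSeries.C (scalarEval w f)) (scalarEval (e (0, w)) f) :=
  IsIterate.heval_right hw hew _

end Iterate

section Reindex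

variable {Γ Γ' : Type*} [AddCommGroup Γ] [LinearOrder Γ] [AddCommGroup Γ'] [LinearOrder Γ']
  {e : Γ ≃+ Γ'}

theorem isReindex_zPow (v : Γ) :
    IsReindex e (zPow v : HahnSeries Γ (Sym K)) (zPow (e v)) :=
  IsReindex.single v 1

variable [IsOrderedAddMonoid Γ] [IsOrderedAddMonoid Γ']

theorem isReindex_scalarEval {v : Γ} (hv : 0 < v) (hev : 0 < e v) (f : PowerSeries K) :
    IsReindex e (scalarEval v f) (scalarEval (e v) f) :=
  IsReindex.heval hv hev _

end Reindex

end Transport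

section Composition

variable {m₁ m₂ m : ℕ} (h : m₁ + m₂ = m)

theorem appendAddEquiv_sub_left (v w : Lex (Fin m₁ → ℤ)) :
    appendAddEquiv h (v - w, 0) = appendAddEquiv h (v, 0) - appendAddEquiv h (w, 0) := by
  rw [← map_sub, Prod.mk_sub_mk, sub_zero]

theorem appendAddEquiv_sub_right (v w : Lex (Fin m₂ → ℤ)) :
    appendAddEquiv h (0, v - w) = appendAddEquiv h (0, v) - appendAddEquiv h (0, w) := by
  rw [← map_sub, Prod.mk_sub_mk, sub_zero]

theorem appendAddEquiv_forward_left (i : Fin m₁) :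
    appendAddEquiv h (forward m₁ i, 0) = forward m ((i.castAdd m₂).cast h) :=
  appendAddEquiv_single_left h i 1

theorem appendAddEquiv_forward_right (j : Fin m₂) :
    appendAddEquiv h (0, forward m₂ j) = forward m ((j.natAdd m₁).cast h) :=
  appendAddEquiv_single_right h j 1

theorem appendAddEquiv_forward_neg_forward (i : Fin m₁) (j : Fin m₂) :
    appendAddEquiv h (forward m₁ i, -forward m₂ j) =
      forward m ((i.castAdd m₂).cast h) - forward m ((j.natAdd m₁).cast h) := by
  rw [← appendAddEquiv_forward_left h i, ← appendAddEquiv_forward_right h j, ← map_sub,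
    Prod.mk_sub_mk, sub_zero, zero_sub]

theorem isIterate_shiftAll (q t : K) (F : Sym K) :
    IsIterate (appendAddEquiv h) (hahnMap (shiftAll q t m₂) (shiftAll q t m₁ F))
      (shiftAll q t m F) := by
  refine isIterate_shift (fun k => ?_) F
  rw [map_sum, map_sum, sum_append h, add_comm]
  refine (IsIterate.sum _ fun i _ => ?_).add (IsIterate.sum _ fun j _ => ?_)
  · rw [← appendAddEquiv_forward_left h, ← map_neg, ← map_nsmul, Prod.neg_mk, Prod.smul_mk,
      neg_zero, smul_zero]
    exact isIterate_single_left _ _ _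
  · rw [← appendAddEquiv_forward_right h, ← map_neg, ← map_nsmul, Prod.neg_mk, Prod.smul_mk,
      neg_zero, smul_zero]
    exact IsIterate.single 0 _ _

theorem isIterate_interaction_left (q t : K) :
    IsIterate (appendAddEquiv h) (hahnMap (shiftAll q t m₂) (interaction q t m₁))
      (∏ x : Fin m₁ × Fin m₁ with x.1 < x.2,
        scalarEval (forward m ((x.1.castAdd m₂).cast h) - forward m ((x.2.castAdd m₂).cast h))
          (omegaM q t)) := by
  rw [interaction, map_prod]
  refine IsIterate.prod _ fun x hx => ?_
  have hpos := sub_pos.mpr (strictAnti_forward m₁ (Finset.mem_filter.mp hx).2)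
  rw [← appendAddEquiv_forward_left, ← appendAddEquiv_forward_left, ← appendAddEquiv_sub_left]
  exact isIterate_scalarEval_left _ hpos (appendAddEquiv_pos_left h hpos 0) _

theorem isIterate_interaction_right (q t : K) :
    IsIterate (appendAddEquiv h) (HahnSeries.C (interaction q t m₂))
      (∏ x : Fin m₂ × Fin m₂ with x.1 < x.2,
        scalarEval (forward m ((x.1.natAdd m₁).cast h) - forward m ((x.2.natAdd m₁).cast h))
          (omegaM q t)) := by
  rw [interaction, map_prod]
  refine IsIterate.prod _ fun x hx => ?_
  have hpos := sub_pos.mpr (strictAnti_forward m₂ (Finset.mem_filter.mp hx).2)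
  rw [← appendAddEquiv_forward_right, ← appendAddEquiv_forward_right, ← appendAddEquiv_sub_right]
  exact isIterate_scalarEval_right hpos (appendAddEquiv_pos_right h hpos) _

variable [CharZero K]

theorem map_shiftAll_OmegaNegX (q t : K) (m : ℕ) :
    PowerSeries.map (shiftAll q t m) OmegaNegX = PowerSeries.map HahnSeries.C OmegaNegX *
      ∏ j, PowerSeries.rescale (zPow (-forward m j))
        (PowerSeries.map HahnSeries.C (OmegaNegM q t)) := by
  have hX := isPlethysticExp_Omega fun k => -(p k : Sym K)
  have hM := isPlethysticExp_Omega fun k => -(MvPolynomial.C (pM q t k) : Sym K)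
  have hprod := (hX.map (HahnSeries.C (Γ := Lex (Fin m → ℤ)))).mul
    (IsPlethysticExp.prod univ fun j _ =>
      (hM.map (HahnSeries.C (Γ := Lex (Fin m → ℤ)))).rescale (zPow (-forward m j)))
  refine (hX.map (shiftAll q t m)).unique ?_
  convert hprod using 1
  · funext k
    rw [map_neg, shiftAll, shift_p, map_neg, neg_add, ← Finset.sum_neg_distrib]
    congr 1
    refine Finset.sum_congr rfl fun j _ => ?_
    rw [← zPow_nsmul, map_neg, mul_neg, mul_comm, zPow, HahnSeries.C_apply,
      HahnSeries.single_mul_single, zero_add, mul_one]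
  · rfl

theorem isIterate_OmegaNegX (q t : K) (i : Fin m₁) :
    IsIterate (appendAddEquiv h)
      (hahnMap (shiftAll q t m₂) (PowerSeries.heval (zPow (forward m₁ i)) OmegaNegX))
      (PowerSeries.heval (zPow (forward m ((i.castAdd m₂).cast h))) OmegaNegX *
        ∏ j : Fin m₂, scalarEval
          (forward m ((i.castAdd m₂).cast h) - forward m ((j.natAdd m₁).cast h))
          (omegaM q t)) := by
  have hpos := forward_pos i
  rw [zPow, hahnMap_heval _ hpos, map_shiftAll_OmegaNegX, map_mul, map_prod]
  refine IsIterate.mul ?_ (IsIterate.prod _ fun j _ => ?_)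
  · rw [← appendAddEquiv_forward_left]
    exact IsIterate.heval_left hpos (appendAddEquiv_pos_left h hpos 0) _
  · rw [← appendAddEquiv_forward_neg_forward, scalarEval_apply, ← OmegaNegM_eq_map]
    exact IsIterate.heval_rescale hpos (appendAddEquiv_pos_left h hpos _) _

theorem isIterate_omegaSeries_left (q t : K) :
    IsIterate (appendAddEquiv h) (hahnMap (shiftAll q t m₂) (omegaSeries m₁))
      ((∏ i : Fin m₁,
          PowerSeries.heval (zPow (forward m ((i.castAdd m₂).cast h))) OmegaNegX) *
        ∏ i : Fin m₁, ∏ j : Fin m₂, scalarEval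
          (forward m ((i.castAdd m₂).cast h) - forward m ((j.natAdd m₁).cast h))
          (omegaM q t)) := by
  rw [omegaSeries, map_prod, ← Finset.prod_mul_distrib]
  exact IsIterate.prod _ fun i _ => isIterate_OmegaNegX h q t i

theorem isIterate_omegaSeries_right :
    IsIterate (appendAddEquiv h) (HahnSeries.C (omegaSeries m₂))
      (∏ j : Fin m₂, PowerSeries.heval (zPow (forward m ((j.natAdd m₁).cast h)))
        (OmegaNegX : PowerSeries (Sym K))) := by
  rw [omegaSeries, map_prod]
  refine IsIterate.prod _ fun j _ => ?_
  rw [← appendAddEquiv_forward_right]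
  exact IsIterate.heval_right (forward_pos j)
    (appendAddEquiv_pos_right h (forward_pos j)) _

/-- Composing two operators substitutes one kernel into the other: the first operator uses the
variables of the left block, the second one those of the right block. -/
theorem kernelOp_mul_kernelOp {q t : K} {g₁ : Series K m₁} {g₂ : Series K m₂}
    {G₁ G₂ : Series K m}
    (h₁ : IsIterate (appendAddEquiv h) (hahnMap (shiftAll q t m₂) g₁) G₁)
    (h₂ : IsIterate (appendAddEquiv h) (HahnSeries.C g₂) G₂) :
    kernelOp q t g₂ * kernelOp q t g₁ = kernelOp q t (G₁ * G₂) := by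
  have rearrange (s o₁ o₂ x g₁ g₂ i₁ i₂ : Series K m) :
      s * (o₁ * x) * (g₁ * i₁) * (o₂ * (g₂ * i₂)) =
        s * (o₁ * o₂) * (g₁ * g₂ * (i₁ * x * i₂)) := by ring
  refine LinearMap.ext fun F => ?_
  have hleft := ((isIterate_shiftAll h q t F).mul (isIterate_omegaSeries_left h q t)).mul
    (h₁.mul (isIterate_interaction_left h q t))
  have hright := (isIterate_omegaSeries_right h).mul
    (h₂.mul (isIterate_interaction_right h q t))
  rw [← map_mul, ← map_mul, ← map_mul] at hleft
  rw [← map_mul, ← map_mul] at hright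
  have hcoeff := hleft.coeff_zero_hahnMap_mul_C hright
  rw [Module.End.mul_apply, kernelOp, kernelOp, kernelOp, vertexOp_apply, vertexOp_apply,
    vertexOp_apply, mul_assoc, hcoeff, omegaSeries, prod_append h, interaction,
    prod_lt_append h fun i j => scalarEval (forward m i - forward m j) (omegaM q t), rearrange]

end Composition

section Symmetry

variable {m : ℕ} (σ : Equiv.Perm (Fin m))

theorem permAddEquiv_forward (i : Fin m) :
    permAddEquiv σ (forward m i) = forward m (σ i) :=
  permAddEquiv_single σ i 1

theorem isReindex_shiftAll (q t : K) (F : Sym K) :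
    IsReindex (permAddEquiv σ) (shiftAll q t m F) (shiftAll q t m F) := by
  refine isReindex_shift (fun k => ?_) F
  nth_rw 2 [← Equiv.sum_comp σ]
  refine IsReindex.sum _ fun i _ => ?_
  rw [← permAddEquiv_forward, ← map_neg, ← map_nsmul]
  exact IsReindex.single _ _

variable [CharZero K]

theorem isReindex_omegaSeries :
    IsReindex (permAddEquiv σ) (omegaSeries m : Series K m) (omegaSeries m) := by
  rw [omegaSeries]
  nth_rw 2 [← Equiv.prod_comp σ]
  refine IsReindex.prod _ fun i _ => ?_
  rw [← permAddEquiv_forward]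
  exact IsReindex.heval (forward_pos i)
    (by rw [permAddEquiv_forward]; exact forward_pos _) _

variable {σ}

theorem vertexOp_eq_zero (q t : K) {x : Series K m} (hx : IsReindex (permAddEquiv σ) x (-x)) :
    vertexOp q t m x = 0 := by
  refine LinearMap.ext fun F => ?_
  have hmul := ((isReindex_shiftAll σ q t F).mul (isReindex_omegaSeries σ)).mul hx
  rw [mul_neg] at hmul
  exact hmul.coeff_zero_of_neg

end Symmetry

section Negut

variable {m : ℕ}

theorem mk_C_pow_eq_map (c : K) :
    (PowerSeries.mk fun r => MvPolynomial.C (c ^ r) : PowerSeries (Sym K)) =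
      PowerSeries.map MvPolynomial.C (geomSeries c) := by
  ext1 r
  rw [PowerSeries.coeff_map, geomSeries, PowerSeries.coeff_mk, PowerSeries.coeff_mk]

theorem C_mul_mono_single_neg (r : Sym K) (i : Fin m) (k : ℕ) :
    HahnSeries.C r * mono (Pi.single i (-(k : ℤ))) = HahnSeries.single (k • -forward m i) r := by
  have hexp : toLex (Pi.single i (-(k : ℤ)) : Fin m → ℤ) = k • -forward m i := by
    rw [forward, ← toLex_neg, ← Pi.single_neg, ← mul_neg_one, ← nsmul_eq_mul, Pi.single_smul]
    rfl
  rw [HahnSeries.C_apply, mono, HahnSeries.single_mul_single, zero_add, mul_one, hexp]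

variable [CharZero K]

theorem N_eq_kernelOp (q t : K) (m n : ℕ) :
    N q t m n = kernelOp q t
      (zPow (toLex fun i : Fin m => -((((i : ℕ) + 1) * n / m : ℕ) - ((i : ℕ) * n / m : ℕ) : ℤ)) *
        ∏ x : Fin m × Fin m with (x.1 : ℕ) + 1 = x.2,
          scalarEval (forward m x.1 - forward m x.2) (geomSeries (q * t))) := by
  refine LinearMap.ext fun F => ?_
  change (negutSeries q t m n F).coeff 0 = _
  rw [kernelOp, vertexOp_apply, negutSeries, mk_C_pow_eq_map, OmegaNegM_eq_map, ← mul_assoc,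
    ← mul_assoc]
  simp only [C_mul_mono_single_neg]
  rfl

end Negut

section OneVariable

/-- Integers as exponent vectors of length one. -/
def intAddEquiv : ℤ ≃+ Lex (Fin 1 → ℤ) where
  toFun k := toLex fun _ => k
  invFun a := ofLex a 0
  left_inv _ := rfl
  right_inv a := ofLex.injective (funext fun i => congrArg (ofLex a) (Subsingleton.elim 0 i))
  map_add' _ _ := rfl

theorem forward_one (i : Fin 1) : forward 1 i = intAddEquiv 1 := by
  apply ofLex.injective
  funext j
  rw [Subsingleton.elim j i, forward, ofLex_toLex, Pi.single_eq_same]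
  rfl

theorem isReindex_shiftAll_one (q t : K) (F : Sym K) :
    IsReindex intAddEquiv
      (shift (fun j : ℕ+ => (HahnSeries.single (-(j : ℤ)) (MvPolynomial.C (pM q t j)) :
        LaurentSeries (Sym K))) F) (shiftAll q t 1 F) := by
  refine isReindex_shift (fun k => ?_) F
  rw [Fin.sum_univ_one, forward_one, ← map_neg, ← map_nsmul, smul_neg, nsmul_one]
  exact IsReindex.single _ _

theorem isReindex_ofPowerSeries (f : PowerSeries (Sym K)) :
    IsReindex intAddEquiv (HahnSeries.ofPowerSeries ℤ (Sym K) f)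
      (PowerSeries.heval (zPow (intAddEquiv 1)) f) := by
  have hpos : 0 < intAddEquiv 1 := forward_one 0 ▸ forward_pos 0
  intro a
  rcases lt_or_ge a 0 with ha | ha
  · rw [zPow, coeff_heval_single_of_ne hpos, HahnSeries.ofPowerSeries_apply,
      HahnSeries.embDomain_of_notMem_range]
    · rintro ⟨n, hn⟩
      exact ha.not_ge (hn ▸ Int.natCast_nonneg n)
    · intro n hn
      rw [← map_nsmul, EmbeddingLike.apply_eq_iff_eq, nsmul_one] at hn
      exact ha.not_ge (hn ▸ Int.natCast_nonneg n)
  · lift a to ℕ using ha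
    rw [HahnSeries.ofPowerSeries_apply_coeff, ← nsmul_one a, map_nsmul, zPow,
      coeff_heval_single hpos]

theorem interaction_one (q t : K) : interaction q t 1 = 1 := by
  rw [interaction, Finset.filter_false_of_mem, Finset.prod_empty]
  intro x _
  rw [Subsingleton.elim x.1 x.2]
  exact lt_irrefl _

variable [CharZero K]

theorem D_eq_kernelOp (q t : K) (k : ℤ) :
    D q t k = kernelOp q t (zPow (toLex fun _ : Fin 1 => -k)) := by
  refine LinearMap.ext fun F => ?_
  have h := (isReindex_shiftAll_one q t F).mul
    (isReindex_ofPowerSeries (PowerSeries.mk fun i => (-1) ^ i * (e i : Sym K)))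
  have hcoeff (x : Series K 1) : (x * zPow (-intAddEquiv k)).coeff 0 = x.coeff (intAddEquiv k) := by
    have hadd := HahnSeries.coeff_mul_single_add (r := (1 : Sym K)) (x := x) (a := intAddEquiv k)
      (b := -intAddEquiv k)
    rwa [add_neg_cancel, mul_one] at hadd
  rw [← OmegaNegX_eq_mk] at h
  rw [kernelOp, vertexOp_apply, interaction_one, mul_one, omegaSeries, Fin.prod_univ_one,
    forward_one]
  refine Eq.trans ?_ (hcoeff _).symm
  rw [h k, OmegaNegX_eq_mk]
  rfl

theorem D_mulBy_e_one (q t : K) (k : ℤ) :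
    D q t k * mulBy (e 1) = mulBy (e 1) * D q t k + ((1 - t) * (1 - q)) • D q t (k + 1) := by
  refine LinearMap.ext fun F => ?_
  have hshift : shift (fun j : ℕ+ => (HahnSeries.single (-(j : ℤ)) (MvPolynomial.C (pM q t j)) :
      LaurentSeries (Sym K))) (e 1) =
        HahnSeries.C (e 1) + HahnSeries.single (-1) (MvPolynomial.C ((1 - t) * (1 - q))) := by
    rw [e_one, shift_p]
    simp [pM]
  have hsingle (x : LaurentSeries (Sym K)) (r : Sym K) :
      (HahnSeries.single (-1) r * x).coeff k = r * x.coeff (k + 1) := by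
    have hadd := HahnSeries.coeff_single_mul_add (r := r) (x := x) (a := k + 1) (b := -1)
    rwa [add_neg_cancel_right] at hadd
  change HahnSeries.coeff (shift _ (e 1 * F) * _) k = e 1 * D q t k F + (_ : K) • D q t (k + 1) F
  rw [map_mul, hshift, add_mul, add_mul, mul_assoc, mul_assoc, HahnSeries.coeff_add,
    HahnSeries.C_mul_eq_smul, HahnSeries.coeff_smul, smul_eq_mul, hsingle,
    MvPolynomial.smul_eq_C_mul]
  rfl

theorem N_one_eq_D (q t : K) (n : ℕ) : N q t 1 n = D q t n := by
  have hexp : (fun i : Fin 1 => -((((i : ℕ) + 1) * n / 1 : ℕ) - ((i : ℕ) * n / 1 : ℕ) : ℤ)) =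
      fun _ => -(n : ℤ) := by
    funext i
    rw [Subsingleton.elim i 0]
    simp
  rw [N_eq_kernelOp, D_eq_kernelOp, hexp, Finset.filter_false_of_mem, Finset.prod_empty, mul_one]
  intro x _
  rw [Subsingleton.elim x.1 x.2]
  exact Nat.succ_ne_self _

end OneVariable

section Split

theorem split_eq {m n a b : ℕ} (ha : 1 ≤ a) (ham : a < m) (hn : 1 < n) (h : m * b + 1 = n * a) :
    split m n = (a, b) := by
  have hm : 1 < m := ha.trans_lt ham
  have hb : 1 ≤ b := by
    by_contra! hb
    rw [Nat.lt_one_iff.mp hb, mul_zero, zero_add] at h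
    exact hn.ne' (Nat.eq_one_of_mul_eq_one_right h.symm)
  have hbn : b < n := by
    by_contra! hlt
    have hmn : n * m ≤ m * b := mul_comm n m ▸ Nat.mul_le_mul_left m hlt
    have hna : n * a < n * m := Nat.mul_lt_mul_of_pos_left ham (zero_lt_one.trans hn)
    omega
  have hex : ∃ r : ℕ × ℕ,
      (1 ≤ r.1 ∧ r.1 ≤ m - 1) ∧ (1 ≤ r.2 ∧ r.2 ≤ n - 1) ∧ m * r.2 + 1 = n * r.1 :=
    ⟨(a, b), ⟨ha, Nat.le_sub_one_of_lt ham⟩, ⟨hb, Nat.le_sub_one_of_lt hbn⟩, h⟩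
  rw [split, if_neg hm.ne', if_neg hn.ne', dif_pos hex]
  obtain ⟨⟨hr₁, hrm⟩, _, hr⟩ := hex.choose_spec
  set r := hex.choose
  have hdvd : (m : ℤ) ∣ r.1 - a := by
    have hcop : IsCoprime (m : ℤ) n := ⟨-b, a, by linarith [(by exact_mod_cast h :
      (m : ℤ) * b + 1 = n * a)]⟩
    zify at h hr
    exact hcop.dvd_of_dvd_mul_left ⟨r.2 - b, by linarith⟩
  have hra : r.1 = a := by
    have hzero := Int.eq_zero_of_abs_lt_dvd hdvd (by rw [abs_lt]; constructor <;> omega)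
    omega
  rw [hra, ← h] at hr
  exact Prod.ext hra (Nat.eq_of_mul_eq_mul_left (zero_lt_one.trans hm) (Nat.succ.inj hr))

variable [CharZero K] {q t : K} {m n a b : ℕ}

theorem Q_eq (q t : K) (hm : 1 ≤ m) (hn : 1 ≤ n) (h : m.Coprime n) (hs : split m n = (a, b)) :
    Q q t m n = ((1 - t) * (1 - q))⁻¹ •
      (Q q t (m - a) (n - b) * Q q t a b - Q q t a b * Q q t (m - a) (n - b)) := by
  rw [Q, dif_pos ⟨hm, hn, h⟩, hs]

theorem Q_one_eq_D (hM : (1 - t) * (1 - q) ≠ 0) (n : ℕ) : Q q t 1 n = D q t n := by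
  induction n with
  | zero =>
    rw [Q, dif_neg (by simp), if_pos ⟨rfl, rfl⟩, Nat.cast_zero]
  | succ n ih =>
    have hQ : Q q t 0 1 = -mulBy (e 1) := by
      rw [Q, dif_neg (by simp), if_neg (by simp), if_pos ⟨rfl, rfl⟩]
    rw [Q_eq q t le_rfl n.succ_pos (Nat.coprime_one_left _) (a := 1) (b := n) (if_pos rfl),
      Nat.sub_self, Nat.succ_eq_add_one, Nat.add_sub_cancel_left, hQ, ih, inv_smul_eq_iff₀ hM,
      neg_mul (mulBy (e 1)) (D q t n), mul_neg (D q t n) (mulBy (e 1)), D_mulBy_e_one,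
      Nat.cast_add_one]
    abel

end Split

section PathKernel

/-- The kernel `z^{-v_l} ∏_{i<l} 1/(1 - c z^{v_i - v_{i+1}})` attached to exponent vectors
`v_0 > ⋯ > v_l`. -/
def pathKernel {Γ : Type*} [AddCommGroup Γ] [LinearOrder Γ] [IsOrderedAddMonoid Γ] (c : K) {l : ℕ}
    (v : Fin (l + 1) → Γ) : HahnSeries Γ (Sym K) :=
  zPow (-v (Fin.last l)) * ∏ i : Fin l, scalarEval (v i.castSucc - v i.succ) (geomSeries c)

/-- The monomial `(z_1 ⋯ z_m)^c`. -/
def prodPow (m : ℕ) (c : ℤ) : Series K m := zPow (toLex fun _ => c)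

section Append

variable {m₁ m₂ m l : ℕ} (h : m₁ + m₂ = m) (c : K)

theorem isIterate_pathKernel_left (q t : K) {v : Fin (l + 1) → Lex (Fin m₁ → ℤ)}
    (hv : StrictAnti v) :
    IsIterate (appendAddEquiv h) (hahnMap (shiftAll q t m₂) (pathKernel c v))
      (pathKernel c fun i => appendAddEquiv h (v i, 0)) := by
  rw [pathKernel, map_mul, map_prod, pathKernel, ← map_neg, Prod.neg_mk, neg_zero]
  refine (isIterate_zPow_left _ _).mul (IsIterate.prod _ fun i _ => ?_)
  have hpos := sub_pos.mpr (hv i.castSucc_lt_succ)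
  rw [← appendAddEquiv_sub_left]
  exact isIterate_scalarEval_left _ hpos (appendAddEquiv_pos_left h hpos 0) _

theorem isIterate_pathKernel_right {v : Fin (l + 1) → Lex (Fin m₂ → ℤ)} (hv : StrictAnti v) :
    IsIterate (appendAddEquiv h) (HahnSeries.C (pathKernel c v))
      (pathKernel c fun i => appendAddEquiv h (0, v i)) := by
  rw [pathKernel, map_mul, map_prod, pathKernel, ← map_neg, Prod.neg_mk, neg_zero]
  refine (isIterate_zPow_right _).mul (IsIterate.prod _ fun i _ => ?_)
  have hpos := sub_pos.mpr (hv i.castSucc_lt_succ)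
  rw [← appendAddEquiv_sub_right]
  exact isIterate_scalarEval_right hpos (appendAddEquiv_pos_right h hpos) _

variable [CharZero K] {q t : K}

theorem kernelOp_prodPow_mul_kernelOp_prodPow {g₁ : Series K m₁} {g₂ : Series K m₂}
    {G₁ G₂ : Series K m} (c : ℤ)
    (h₁ : IsIterate (appendAddEquiv h) (hahnMap (shiftAll q t m₂) g₁) G₁)
    (h₂ : IsIterate (appendAddEquiv h) (HahnSeries.C g₂) G₂) :
    kernelOp q t (prodPow m₂ c * g₂) * kernelOp q t (prodPow m₁ c * g₁) =
      kernelOp q t (prodPow m c * (G₁ * G₂)) := by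
  have hpow : IsIterate (appendAddEquiv h) (hahnMap (shiftAll q t m₂) (prodPow m₁ c))
      (zPow (appendAddEquiv h (toLex fun _ => c, 0))) := isIterate_zPow_left _ _
  have hleft := hpow.mul h₁
  have hright := (isIterate_zPow_right (e := appendAddEquiv h) (toLex fun _ => c)).mul h₂
  rw [← map_mul] at hleft
  rw [← map_mul] at hright
  have hconst : (prodPow m c : Series K m) =
      zPow (appendAddEquiv h (toLex fun _ => c, 0)) *
        zPow (appendAddEquiv h (0, toLex fun _ => c)) := by
    rw [← zPow_add, ← map_add, Prod.mk_add_mk, add_zero, zero_add, appendAddEquiv_const, prodPow]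
  rw [prodPow, kernelOp_mul_kernelOp h hleft hright, hconst, mul_mul_mul_comm]

theorem kernelOp_mul_D {m₂ m : ℕ} (h : 1 + m₂ = m) {g : Series K m₂} {G : Series K m}
    (hG : IsIterate (appendAddEquiv h) (HahnSeries.C g) G) (k : ℤ) :
    kernelOp q t (prodPow m₂ (-k) * g) * D q t k = kernelOp q t (prodPow m (-k) * G) := by
  have hone : IsIterate (appendAddEquiv h) (hahnMap (shiftAll q t m₂) 1) (1 : Series K m) := by
    rw [map_one]
    exact IsIterate.C 1
  rw [D_eq_kernelOp, ← prodPow, ← mul_one (prodPow 1 (-k)),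
    kernelOp_prodPow_mul_kernelOp_prodPow h (-k) hone hG, one_mul]

theorem D_mul_kernelOp {m₁ m : ℕ} (h : m₁ + 1 = m) {g : Series K m₁} {G : Series K m}
    (hG : IsIterate (appendAddEquiv h) (hahnMap (shiftAll q t 1) g) G) (k : ℤ) :
    D q t k * kernelOp q t (prodPow m₁ (-k) * g) = kernelOp q t (prodPow m (-k) * G) := by
  have hone : IsIterate (appendAddEquiv h) (HahnSeries.C 1) (1 : Series K m) := IsIterate.C 1
  rw [D_eq_kernelOp, ← prodPow, ← mul_one (prodPow 1 (-k)),
    kernelOp_prodPow_mul_kernelOp_prodPow h (-k) hG hone, mul_one]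

end Append

section Negut

theorem prod_consecutive {M : Type*} [CommMonoid M] {m : ℕ} (f : Fin (m + 1) → Fin (m + 1) → M) :
    ∏ x : Fin (m + 1) × Fin (m + 1) with (x.1 : ℕ) + 1 = x.2, f x.1 x.2 =
      ∏ i : Fin m, f i.castSucc i.succ := by
  refine (Finset.prod_bij (fun i _ => (i.castSucc, i.succ)) (fun i _ => ?_) (fun i _ j _ hij => ?_)
    (fun x hx => ?_) fun _ _ => rfl).symm
  · simp
  · exact Fin.castSucc_injective m (congrArg Prod.fst hij)
  · have hx : (x.1 : ℕ) + 1 = x.2 := (Finset.mem_filter.mp hx).2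
    exact ⟨⟨x.1, by omega⟩, mem_univ _, Prod.ext (Fin.ext rfl) (Fin.ext hx)⟩

theorem pathKernel_backward (c : K) (m : ℕ) :
    (pathKernel c (backward (m + 1)) : Series K (m + 1)) = zPow (forward (m + 1) 0) *
      ∏ i : Fin m, scalarEval (forward (m + 1) i.castSucc - forward (m + 1) i.succ)
        (geomSeries c) := by
  rw [pathKernel, ← Equiv.prod_comp Fin.revPerm]
  simp only [backward_eq_neg_forward_rev, Fin.rev_last, neg_neg, Fin.revPerm_apply,
    Fin.rev_castSucc, Fin.rev_succ, Fin.rev_rev, neg_sub_neg]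

variable [CharZero K]

theorem N_succ_eq_kernelOp (q t : K) (m k r : ℕ) :
    N q t (m + 1) ((m + 1) * k + r) = kernelOp q t (prodPow (m + 1) (-k) *
      (zPow (toLex fun i : Fin (m + 1) =>
        ((i * r / (m + 1) : ℕ) - (((i : ℕ) + 1) * r / (m + 1) : ℕ) : ℤ)) *
        ∏ i : Fin m, scalarEval (forward (m + 1) i.castSucc - forward (m + 1) i.succ)
          (geomSeries (q * t)))) := by
  have hfloor (j : ℕ) : j * ((m + 1) * k + r) / (m + 1) = j * k + j * r / (m + 1) := by
    rw [mul_add, mul_left_comm, Nat.mul_add_div m.succ_pos]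
  rw [N_eq_kernelOp, prod_consecutive fun i j =>
    scalarEval (forward (m + 1) i - forward (m + 1) j) (geomSeries (q * t)), ← mul_assoc, prodPow,
    ← zPow_add, ← toLex_add]
  congr 4
  funext i
  rw [hfloor, hfloor, Pi.add_apply]
  push_cast
  ring

theorem N_eq_kernelOp_forward (q t : K) (m k : ℕ) :
    N q t (m + 1) ((m + 1) * k + 1) =
      kernelOp q t (prodPow (m + 1) (-k) * pathKernel (q * t) (forward (m + 1))) := by
  have hexp : (fun i : Fin (m + 1) =>
      ((i * 1 / (m + 1) : ℕ) - (((i : ℕ) + 1) * 1 / (m + 1) : ℕ) : ℤ)) =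
        Pi.single (Fin.last m) (-1) := by
    funext i
    rw [mul_one, mul_one, Nat.div_eq_of_lt i.is_lt]
    rcases Fin.eq_castSucc_or_eq_last i with ⟨j, rfl⟩ | rfl
    · rw [Fin.val_castSucc, Nat.div_eq_of_lt (Nat.succ_lt_succ j.is_lt),
        Pi.single_eq_of_ne j.castSucc_lt_last.ne, sub_self]
    · rw [Fin.val_last, Nat.div_self m.succ_pos, Pi.single_eq_same]
      rfl
  rw [N_succ_eq_kernelOp, hexp, Pi.single_neg, toLex_neg, ← forward, pathKernel]

theorem N_eq_kernelOp_backward (q t : K) (m k : ℕ) :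
    N q t (m + 1) ((m + 1) * k + m) =
      kernelOp q t (prodPow (m + 1) (-(k + 1)) * pathKernel (q * t) (backward (m + 1))) := by
  have hfloor (j : ℕ) (hj : j ≤ m) : (j + 1) * m / (m + 1) = j := by
    exact Nat.div_eq_of_lt_le (by nlinarith) (by nlinarith)
  have hexp : (fun i : Fin (m + 1) =>
      ((i * m / (m + 1) : ℕ) - (((i : ℕ) + 1) * m / (m + 1) : ℕ) : ℤ)) =
        (fun _ => -1) + Pi.single 0 1 := by
    funext i
    rw [hfloor i i.is_le]
    rcases Fin.eq_zero_or_eq_succ i with rfl | ⟨j, rfl⟩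
    · simp
    · rw [Fin.val_succ, hfloor j j.is_lt.le, Pi.add_apply, Pi.single_eq_of_ne j.succ_ne_zero]
      push_cast
      ring
  have hconst : (prodPow (m + 1) (-(k + 1)) : Series K (m + 1)) =
      prodPow (m + 1) (-k) * zPow (toLex fun _ => -1) := by
    rw [prodPow, prodPow, ← zPow_add, neg_add]
    rfl
  rw [N_succ_eq_kernelOp, hexp, toLex_add, zPow_add, pathKernel_backward, hconst, ← forward]
  simp only [mul_assoc]

end Negut

end PathKernel

section Recursion

variable {m : ℕ}

/-- The sequence `z^{v_1}, …, z^{v_m}` is either `z_1, …, z_m` or `1 / z_m, …, 1 / z_1`. -/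
def IsOrientation (v : Fin m → Lex (Fin m → ℤ)) : Prop := v = forward m ∨ v = backward m

/-- The kernel of `[N, D] - M N'`, for the operators `N` and `N'` whose kernels are the path
kernels in `m + 1` and `m + 2` variables. -/
def commutatorKernel (q t : K) (v : Fin (m + 2) → Lex (Fin (m + 2) → ℤ)) : Series K (m + 2) :=
  pathKernel (q * t) (v ∘ Fin.succ) - pathKernel (q * t) (v ∘ Fin.castSucc) -
    ((1 - t) * (1 - q)) • pathKernel (q * t) v

variable [CharZero K] {q t : K}

/-- The commutator kernels in `m + 2` variables define the zero operator. -/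
def CommutatorVanishes (q t : K) (m : ℕ) : Prop :=
  ∀ (c : ℤ) (v : Fin (m + 2) → Lex (Fin (m + 2) → ℤ)), IsOrientation v →
    kernelOp q t (prodPow (m + 2) c * commutatorKernel q t v) = 0

theorem CommutatorVanishes.sub_eq_smul (h : CommutatorVanishes q t m) (c : ℤ)
    {v : Fin (m + 2) → Lex (Fin (m + 2) → ℤ)} (hv : IsOrientation v) :
    kernelOp q t (prodPow (m + 2) c * pathKernel (q * t) (v ∘ Fin.succ)) -
        kernelOp q t (prodPow (m + 2) c * pathKernel (q * t) (v ∘ Fin.castSucc)) =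
      ((1 - t) * (1 - q)) • kernelOp q t (prodPow (m + 2) c * pathKernel (q * t) v) := by
  rw [← sub_eq_zero, ← h c v hv, commutatorKernel]
  simp only [kernelOp, ← map_sub, ← map_smul, mul_sub, sub_mul, mul_smul_comm, smul_mul_assoc]

theorem kernelOp_forward_mul_D (k : ℤ) :
    kernelOp q t (prodPow (m + 1) (-k) * pathKernel (q * t) (forward (m + 1))) * D q t k =
      kernelOp q t (prodPow (m + 2) (-k) * pathKernel (q * t) (forward (m + 2) ∘ Fin.succ)) := by
  have h : 1 + (m + 1) = m + 2 := by ring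
  have hv : (fun i => appendAddEquiv h (0, forward (m + 1) i)) = forward (m + 2) ∘ Fin.succ := by
    funext i
    rw [appendAddEquiv_forward_right, Function.comp_apply]
    exact congrArg _ (Fin.ext (add_comm 1 (i : ℕ)))
  rw [kernelOp_mul_D h (isIterate_pathKernel_right h _ (strictAnti_forward _)), hv]

theorem D_mul_kernelOp_forward (k : ℤ) :
    D q t k * kernelOp q t (prodPow (m + 1) (-k) * pathKernel (q * t) (forward (m + 1))) =
      kernelOp q t
        (prodPow (m + 2) (-k) * pathKernel (q * t) (forward (m + 2) ∘ Fin.castSucc)) := by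
  have hv : (fun i => appendAddEquiv (m₂ := 1) rfl (forward (m + 1) i, 0)) =
      forward (m + 2) ∘ Fin.castSucc := by
    funext i
    exact appendAddEquiv_forward_left rfl i
  rw [D_mul_kernelOp rfl (isIterate_pathKernel_left rfl _ q t (strictAnti_forward _)), hv]

theorem kernelOp_backward_mul_D (k : ℤ) :
    kernelOp q t (prodPow (m + 1) (-k) * pathKernel (q * t) (backward (m + 1))) * D q t k =
      kernelOp q t
        (prodPow (m + 2) (-k) * pathKernel (q * t) (backward (m + 2) ∘ Fin.castSucc)) := by
  have h : 1 + (m + 1) = m + 2 := by ring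
  have hv : (fun i => appendAddEquiv h (0, backward (m + 1) i)) =
      backward (m + 2) ∘ Fin.castSucc := by
    funext i
    rw [Function.comp_apply, backward_eq_neg_forward_rev, backward_eq_neg_forward_rev,
      Fin.rev_castSucc, ← neg_zero, ← Prod.neg_mk, map_neg, appendAddEquiv_forward_right]
    exact congrArg (-forward _ ·) (Fin.ext (add_comm 1 (i.rev : ℕ)))
  rw [kernelOp_mul_D h (isIterate_pathKernel_right h _ (strictAnti_backward _)), hv]

theorem D_mul_kernelOp_backward (k : ℤ) :
    D q t k * kernelOp q t (prodPow (m + 1) (-k) * pathKernel (q * t) (backward (m + 1))) =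
      kernelOp q t (prodPow (m + 2) (-k) * pathKernel (q * t) (backward (m + 2) ∘ Fin.succ)) := by
  have hv : (fun i => appendAddEquiv (m₂ := 1) rfl (backward (m + 1) i, 0)) =
      backward (m + 2) ∘ Fin.succ := by
    funext i
    rw [Function.comp_apply, backward_eq_neg_forward_rev, backward_eq_neg_forward_rev,
      Fin.rev_succ, ← neg_zero, ← Prod.neg_mk, map_neg, appendAddEquiv_forward_left]
    rfl
  rw [D_mul_kernelOp rfl (isIterate_pathKernel_left rfl _ q t (strictAnti_backward _)), hv]

theorem commutator_N_D (h : CommutatorVanishes q t m) (k : ℕ) :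
    N q t (m + 1) ((m + 1) * k + 1) * D q t k - D q t k * N q t (m + 1) ((m + 1) * k + 1) =
      ((1 - t) * (1 - q)) • N q t (m + 2) ((m + 2) * k + 1) := by
  rw [N_eq_kernelOp_forward, N_eq_kernelOp_forward, kernelOp_forward_mul_D, D_mul_kernelOp_forward]
  exact h.sub_eq_smul _ (Or.inl rfl)

theorem commutator_D_N (h : CommutatorVanishes q t m) (k : ℕ) :
    D q t (k + 1) * N q t (m + 1) ((m + 1) * k + m) -
        N q t (m + 1) ((m + 1) * k + m) * D q t (k + 1) =
      ((1 - t) * (1 - q)) • N q t (m + 2) ((m + 2) * k + (m + 1)) := by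
  rw [N_eq_kernelOp_backward, N_eq_kernelOp_backward, kernelOp_backward_mul_D,
    D_mul_kernelOp_backward]
  exact h.sub_eq_smul _ (Or.inr rfl)

theorem Q_eq_N_of_modEq_one (hM : (1 - t) * (1 - q) ≠ 0) (h : ∀ l < m, CommutatorVanishes q t l)
    (k : ℕ) : Q q t (m + 1) ((m + 1) * k + 1) = N q t (m + 1) ((m + 1) * k + 1) := by
  induction m with
  | zero => rw [zero_add, Q_one_eq_D hM, N_one_eq_D]
  | succ m ih =>
    have hsplit : split (m + 2) ((m + 2) * k + 1) = (1, k) := by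
      rcases Nat.eq_zero_or_pos k with rfl | hk
      · simp [split]
      · exact split_eq le_rfl (by omega) (by nlinarith) (mul_one _).symm
    have hsub : (m + 2) * k + 1 - k = (m + 1) * k + 1 := by
      rw [Nat.sub_eq_iff_eq_add (by nlinarith)]
      ring
    rw [Q_eq q t (by omega) (by omega) (by simp) hsplit, hsub, Nat.add_sub_cancel_right (m + 1) 1,
      ih fun l hl => h l (hl.trans m.lt_succ_self), Q_one_eq_D hM,
      commutator_N_D (h m m.lt_succ_self), inv_smul_smul₀ hM]

theorem Q_eq_N_of_modEq_neg_one (hM : (1 - t) * (1 - q) ≠ 0)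
    (h : ∀ l < m, CommutatorVanishes q t l) (k : ℕ) :
    Q q t (m + 1) ((m + 1) * k + m) = N q t (m + 1) ((m + 1) * k + m) := by
  induction m with
  | zero => rw [zero_add, Q_one_eq_D hM, N_one_eq_D]
  | succ m ih =>
    have hbezout : (m + 2) * ((m + 1) * k + m) + 1 = ((m + 2) * k + (m + 1)) * (m + 1) := by ring
    have hsplit : split (m + 2) ((m + 2) * k + (m + 1)) = (m + 1, (m + 1) * k + m) := by
      rcases Nat.eq_zero_or_pos (k + m) with hkm | hkm
      · obtain ⟨rfl, rfl⟩ := Nat.add_eq_zero_iff.mp hkm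
        rfl
      · exact split_eq (by omega) (by omega) (by nlinarith) hbezout
    have hcoprime : (m + 2).Coprime ((m + 2) * k + (m + 1)) := by
      rw [Nat.coprime_mul_left_add_right]
      exact Nat.coprime_self_add_left.mpr (Nat.coprime_one_left _)
    have hsub : (m + 2) * k + (m + 1) - ((m + 1) * k + m) = k + 1 := by
      rw [Nat.sub_eq_iff_eq_add (by nlinarith)]
      ring
    rw [Q_eq q t (by omega) (by omega) hcoprime hsplit, hsub, Nat.add_sub_cancel_left (m + 1) 1,
      ih fun l hl => h l (hl.trans m.lt_succ_self), Q_one_eq_D hM, Nat.cast_add_one,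
      commutator_D_N (h m m.lt_succ_self), inv_smul_smul₀ hM]

end Recursion

section KernelIdentities

variable {R : Type*} [CommRing R] {m : ℕ} {q t : R} {y u : Fin m → R} {G W : Fin m → Fin m → R}

/-- The relations among monomials `y i` with inverses `u i` and, for `i < j` and `r = y i * u j`,
the factors `G i j = 1 / (1 - q t r)` and `W i j = Ω[-M r]`, written without division. -/
structure IsKernelFamily (q t : R) (y u : Fin m → R) (G W : Fin m → Fin m → R) : Prop where
  mul_eq_one (i : Fin m) : y i * u i = 1
  geom_mul {i j : Fin m} (hij : i < j) : G i j * (1 - q * t * (y i * u j)) = 1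
  omega_mul {i j : Fin m} (hij : i < j) :
    W i j * ((1 - t * (y i * u j)) * (1 - q * (y i * u j))) =
      (1 - y i * u j) * (1 - q * t * (y i * u j))

theorem IsKernelFamily.geom_mul_omega_mul (h : IsKernelFamily q t y u G W) {i j : Fin m}
    (hij : i < j) :
    G i j * W i j * ((1 - t * (y i * u j)) * (1 - q * (y i * u j))) = 1 - y i * u j := by
  linear_combination G i j * h.omega_mul hij + (1 - y i * u j) * h.geom_mul hij

theorem IsKernelFamily.geom_difference (h : IsKernelFamily q t y u G W) {i j k l : Fin m}
    (hij : i < j) (hkl : k < l) :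
    u l * G k l - u k * G i j - (1 - t) * (1 - q) * (u l * (G i j * G k l)) =
      -(G i j * G k l * (u k - (q + t) * u l + q * t * (y i * u j * u l))) := by
  linear_combination (u k * G i j) * h.geom_mul hkl - (u l * G k l) * h.geom_mul hij +
    (q * t * u l * G i j * G k l) * h.mul_eq_one k

theorem IsKernelFamily.identity_two {y u : Fin 2 → R} {G W : Fin 2 → Fin 2 → R}
    (h : IsKernelFamily q t y u G W) :
    (u 1 - u 0 - (1 - t) * (1 - q) * (u 1 * G 0 1)) * W 0 1 = -(u 0 - u 1) := by
  have h01 : (0 : Fin 2) < 1 := by decide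
  have hy := h.mul_eq_one 0
  have hG := h.geom_mul h01
  have hGW := h.geom_mul_omega_mul h01
  grind

theorem IsKernelFamily.identity_three {y u : Fin 3 → R} {G W : Fin 3 → Fin 3 → R}
    (h : IsKernelFamily q t y u G W) :
    (u 2 * G 1 2 - u 1 * G 0 1 - (1 - t) * (1 - q) * (u 2 * (G 0 1 * G 1 2))) *
        (W 0 1 * W 0 2 * W 1 2) =
      q * t * (u 2 * u 2 * (y 1 - y 0) * (G 0 2 * G 1 2 * (W 0 2 * W 1 2))) -
        (u 1 - u 2) * (G 0 1 * G 0 2 * (W 0 1 * W 0 2)) := by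
  have h01 : (0 : Fin 3) < 1 := by decide
  have h12 : (1 : Fin 3) < 2 := by decide
  have h02 : (0 : Fin 3) < 2 := by decide
  have hsplit : u 1 - (q + t) * u 2 + q * t * (y 0 * u 1 * u 2) =
      G 0 2 * (u 1 * ((1 - t * (y 1 * u 2)) * (1 - q * (y 1 * u 2))) -
        q * t * (y 1 * u 2 ^ 2) * ((1 - t * (y 0 * u 1)) * (1 - q * (y 0 * u 1)))) := by
    have := h.mul_eq_one 1
    have := h.geom_mul h02
    grind
  rw [h.geom_difference h01 h12, hsplit]
  linear_combination
    (-G 0 2 * W 0 2 * G 0 1 * W 0 1 * u 1) * h.geom_mul_omega_mul h12 +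
    (q * t * G 0 2 * W 0 2 * G 1 2 * W 1 2 * y 1 * u 2 ^ 2) * h.geom_mul_omega_mul h01 +
    (G 0 2 * W 0 2 * (G 0 1 * W 0 1 * u 2 - q * t * G 1 2 * W 1 2 * u 2 ^ 2 * y 0)) *
      h.mul_eq_one 1

theorem IsKernelFamily.numerator_four {y u : Fin 4 → R} {G W : Fin 4 → Fin 4 → R}
    (h : IsKernelFamily q t y u G W) :
    u 2 - (q + t) * u 3 + q * t * (y 0 * u 1 * u 3) =
      G 1 3 * (u 2 * ((1 - t * (y 2 * u 3)) * (1 - q * (y 2 * u 3)))) +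
        q * t * (u 3 * (y 0 * u 1 - y 2 * u 3)) * G 0 2 * G 1 3 *
          ((1 - t * (y 1 * u 2)) * (1 - q * (y 1 * u 2))) -
        q * t * (y 1 * u 2 * u 3) * G 0 2 *
          ((1 - t * (y 0 * u 1)) * (1 - q * (y 0 * u 1))) := by
  have h02 : (0 : Fin 4) < 2 := by decide
  have h13 : (1 : Fin 4) < 3 := by decide
  have hcleared : (u 2 - (q + t) * u 3 + q * t * (y 0 * u 1 * u 3)) *
      ((1 - q * t * (y 0 * u 2)) * (1 - q * t * (y 1 * u 3))) =
      u 2 * ((1 - t * (y 2 * u 3)) * (1 - q * (y 2 * u 3))) * (1 - q * t * (y 0 * u 2)) +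
        q * t * (u 3 * (y 0 * u 1 - y 2 * u 3)) *
          ((1 - t * (y 1 * u 2)) * (1 - q * (y 1 * u 2))) -
        q * t * (y 1 * u 2 * u 3) * ((1 - t * (y 0 * u 1)) * (1 - q * (y 0 * u 1))) *
          (1 - q * t * (y 1 * u 3)) := by
    have := h.mul_eq_one 1
    have := h.mul_eq_one 2
    grind
  linear_combination G 0 2 * G 1 3 * hcleared +
    (G 1 3 * (u 2 * ((1 - t * (y 2 * u 3)) * (1 - q * (y 2 * u 3)))) -
      (u 2 - (q + t) * u 3 + q * t * (y 0 * u 1 * u 3))) * h.geom_mul h02 -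
    ((u 2 - (q + t) * u 3 + q * t * (y 0 * u 1 * u 3)) * G 0 2 * (1 - q * t * (y 0 * u 2)) +
      q * t * (y 1 * u 2 * u 3) * G 0 2 * ((1 - t * (y 0 * u 1)) * (1 - q * (y 0 * u 1)))) *
      h.geom_mul h13

theorem IsKernelFamily.identity_four {y u : Fin 4 → R} {G W : Fin 4 → Fin 4 → R}
    (h : IsKernelFamily q t y u G W) :
    (u 3 * (G 1 2 * G 2 3) - u 2 * (G 0 1 * G 1 2) -
        (1 - t) * (1 - q) * (u 3 * (G 0 1 * G 1 2 * G 2 3))) *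
        (W 0 1 * W 0 2 * W 0 3 * W 1 2 * W 1 3 * W 2 3) =
      q * t * (u 2 * u 3 * (y 1 - y 0) * ((G 0 2 * (G 1 2 * G 2 3)) *
          (W 0 2 * (W 0 3 * (W 1 2 * (W 1 3 * W 2 3)))))) -
        q * t * ((y 0 * u 3 * (u 1 - u 2) + u 3 * u 3 * (y 1 - y 2)) *
          ((G 0 1 * (G 0 2 * (G 1 3 * G 2 3))) *
            (W 0 1 * (W 0 2 * (W 0 3 * (W 1 3 * W 2 3)))))) -
        (u 2 - u 3) * ((G 0 1 * (G 1 2 * G 1 3)) *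
          (W 0 1 * (W 0 2 * (W 0 3 * (W 1 2 * W 1 3))))) := by
  have h01 : (0 : Fin 4) < 1 := by decide
  have h12 : (1 : Fin 4) < 2 := by decide
  have h23 : (2 : Fin 4) < 3 := by decide
  have hnum := h.geom_difference h01 h23
  rw [h.numerator_four] at hnum
  linear_combination
    G 1 2 * (W 0 1 * W 0 2 * W 0 3 * W 1 2 * W 1 3 * W 2 3) * hnum -
    (G 0 1 * W 0 1 * G 1 2 * W 1 2 * G 1 3 * W 1 3 * W 0 2 * W 0 3 * u 2) *
      h.geom_mul_omega_mul h23 -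
    (q * t * u 3 * (y 0 * u 1 - y 2 * u 3) * G 0 1 * W 0 1 * G 0 2 * W 0 2 * G 1 3 * W 1 3 *
      G 2 3 * W 2 3 * W 0 3) * h.geom_mul_omega_mul h12 +
    (q * t * y 1 * u 2 * u 3 * G 2 3 * W 2 3 * G 1 2 * W 1 2 * G 0 2 * W 0 2 * W 0 3 * W 1 3) *
      h.geom_mul_omega_mul h01 +
    (q * t * W 0 3 * G 0 2 * W 0 2 * G 2 3 * W 2 3 * y 0 * u 2 * u 3 *
      (G 0 1 * W 0 1 * G 1 3 * W 1 3 - G 1 2 * W 1 2 * W 1 3)) * h.mul_eq_one 1 +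
    (G 0 1 * W 0 1 * G 1 3 * W 1 3 * W 0 2 * W 0 3 *
      (G 1 2 * W 1 2 * u 3 - q * t * G 0 2 * G 2 3 * W 2 3 * u 3 ^ 2 * y 1)) * h.mul_eq_one 2

end KernelIdentities

section Antisymmetry

theorem isKernelFamily_of_strictAnti {Γ : Type*} [AddCommGroup Γ] [LinearOrder Γ]
    [IsOrderedAddMonoid Γ] {m : ℕ} {v : Fin m → Γ} (hv : StrictAnti v) (q t : K) :
    IsKernelFamily (scalar q : HahnSeries Γ (Sym K)) (scalar t) (fun i => zPow (v i))
      (fun i => zPow (-v i)) (fun i j => scalarEval (v i - v j) (geomSeries (q * t)))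
      fun i j => scalarEval (v i - v j) (omegaM q t) where
  mul_eq_one i := by
    rw [← zPow_add, add_neg_cancel]
    rfl
  geom_mul {i j} hij := by
    rw [← zPow_add, ← sub_eq_add_neg, ← map_mul, ← scalarEval_C (v i - v j),
      ← scalarEval_X (sub_pos.mpr (hv hij)), ← map_mul, ← map_one (scalarEval (v i - v j)),
      ← map_sub, ← map_mul, geomSeries_mul_one_sub]
  omega_mul {i j} hij := by
    rw [← zPow_add, ← sub_eq_add_neg, ← map_mul, ← scalarEval_X (sub_pos.mpr (hv hij))]
    simp only [← scalarEval_C (v i - v j), ← map_mul, ← map_one (scalarEval (v i - v j)),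
      ← map_sub, omegaM_mul]

variable {m : ℕ} {v : Fin m → Lex (Fin m → ℤ)}

theorem IsOrientation.strictAnti (hv : IsOrientation v) : StrictAnti v := by
  rcases hv with rfl | rfl
  exacts [strictAnti_forward m, strictAnti_backward m]

theorem IsOrientation.exists_permAddEquiv (hv : IsOrientation v) (σ : Equiv.Perm (Fin m)) :
    ∃ τ, ∀ i, permAddEquiv τ (v i) = v (σ i) := by
  rcases hv with rfl | rfl
  · exact ⟨σ, permAddEquiv_forward σ⟩
  · refine ⟨Fin.revPerm.permCongr σ, fun i => ?_⟩
    rw [backward_eq_neg_forward_rev, backward_eq_neg_forward_rev, map_neg, permAddEquiv_forward]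
    simp

theorem IsOrientation.interaction_eq (hv : IsOrientation v) (q t : K) :
    interaction q t m =
      ∏ x : Fin m × Fin m with x.1 < x.2, scalarEval (v x.1 - v x.2) (omegaM q t) := by
  rcases hv with rfl | rfl
  · rfl
  · rw [interaction]
    refine Finset.prod_nbij' (fun x => (x.2.rev, x.1.rev)) (fun x => (x.2.rev, x.1.rev))
      ?_ ?_ ?_ ?_ ?_ <;>
      simp [backward_eq_neg_forward_rev, neg_add_eq_sub]

variable {σ τ : Equiv.Perm (Fin m)}

theorem isReindex_zPow_apply (hτ : ∀ i, permAddEquiv τ (v i) = v (σ i)) (i : Fin m) :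
    IsReindex (permAddEquiv τ) (zPow (v i) : Series K m) (zPow (v (σ i))) :=
  hτ i ▸ isReindex_zPow (v i)

theorem isReindex_zPow_neg_apply (hτ : ∀ i, permAddEquiv τ (v i) = v (σ i))
    (i : Fin m) :
    IsReindex (permAddEquiv τ) (zPow (-v i) : Series K m) (zPow (-v (σ i))) := by
  rw [← hτ, ← map_neg]
  exact isReindex_zPow _

theorem isReindex_zPow_sub (hτ : ∀ i, permAddEquiv τ (v i) = v (σ i)) {i j : Fin m}
    (hij : σ i = j) (hji : σ j = i) :
    IsReindex (permAddEquiv τ) (zPow (v i) - zPow (v j) : Series K m)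
      (-(zPow (v i) - zPow (v j))) := by
  have hi := isReindex_zPow_apply (K := K) hτ i
  have hj := isReindex_zPow_apply (K := K) hτ j
  rw [hij] at hi
  rw [hji] at hj
  exact neg_sub (zPow (v i) : Series K m) _ ▸ hi.sub hj

theorem isReindex_zPow_neg_sub (hτ : ∀ i, permAddEquiv τ (v i) = v (σ i)) {i j : Fin m}
    (hij : σ i = j) (hji : σ j = i) :
    IsReindex (permAddEquiv τ) (zPow (-v i) - zPow (-v j) : Series K m)
      (-(zPow (-v i) - zPow (-v j))) :=
  isReindex_zPow_sub (v := -v) (fun i => by simp [hτ]) hij hji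

theorem isReindex_prod_scalarEval (hτ : ∀ i, permAddEquiv τ (v i) = v (σ i))
    (hv : StrictAnti v) {S : Finset (Fin m × Fin m)} (hlt : ∀ x ∈ S, x.1 < x.2)
    (hS : S.image (Prod.map σ σ) = S) (f : PowerSeries K) :
    IsReindex (permAddEquiv τ) (∏ x ∈ S, scalarEval (v x.1 - v x.2) f)
      (∏ x ∈ S, scalarEval (v x.1 - v x.2) f) := by
  have himage : ∏ x ∈ S, scalarEval (v x.1 - v x.2) f =
      ∏ x ∈ S, scalarEval (v (σ x.1) - v (σ x.2)) f := by
    conv_lhs => rw [← hS]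
    exact Finset.prod_image ((σ.injective.prodMap σ.injective).injOn)
  rw (occs := [2]) [himage]
  refine IsReindex.prod _ fun x hx => ?_
  have hσx : σ x.1 < σ x.2 := hlt (Prod.map σ σ x) (hS ▸ Finset.mem_image_of_mem _ hx)
  rw [← hτ, ← hτ, ← map_sub]
  refine isReindex_scalarEval (sub_pos.mpr (hv (hlt x hx))) ?_ f
  rw [map_sub, hτ, hτ]
  exact sub_pos.mpr (hv hσx)

theorem vertexOp_prodPow_mul_eq_zero [CharZero K]
    (hτ : ∀ i, permAddEquiv τ (v i) = v (σ i)) (hv : StrictAnti v) (q t : K) (c : ℤ)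
    {P : Series K m} (hP : IsReindex (permAddEquiv τ) P (-P)) (S T : Finset (Fin m × Fin m))
    (hS : (∀ x ∈ S, x.1 < x.2) ∧ S.image (Prod.map σ σ) = S)
    (hT : (∀ x ∈ T, x.1 < x.2) ∧ T.image (Prod.map σ σ) = T) :
    vertexOp q t m (prodPow m c * (P *
      ((∏ x ∈ S, scalarEval (v x.1 - v x.2) (geomSeries (q * t))) *
        ∏ x ∈ T, scalarEval (v x.1 - v x.2) (omegaM q t)))) = 0 := by
  have hpow : IsReindex (permAddEquiv τ) (prodPow m c : Series K m) (prodPow m c) := by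
    rw [prodPow]
    nth_rw 2 [← permAddEquiv_const τ c]
    exact isReindex_zPow _
  have hG := isReindex_prod_scalarEval hτ hv hS.1 hS.2 (geomSeries (q * t))
  have hW := isReindex_prod_scalarEval hτ hv hT.1 hT.2 (omegaM q t)
  refine vertexOp_eq_zero q t (σ := τ) ?_
  rw [← mul_neg (prodPow m c : Series K m), ← neg_mul P]
  exact hpow.mul (hP.mul (hG.mul hW))

end Antisymmetry

section Vanishing

theorem IsOrientation.commutatorKernel_mul_interaction_two {v : Fin 2 → Lex (Fin 2 → ℤ)}
    (hv : IsOrientation v) (q t : K) :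
    commutatorKernel q t v * interaction q t 2 = -(zPow (-v 0) - zPow (-v 1)) := by
  rw [← (isKernelFamily_of_strictAnti hv.strictAnti q t).identity_two, hv.interaction_eq]
  simp [commutatorKernel, pathKernel, Finset.prod_filter, Fintype.prod_prod_type,
    Fin.prod_univ_succ, smul_eq_scalar_mul]

theorem IsOrientation.commutatorKernel_mul_interaction_three {v : Fin 3 → Lex (Fin 3 → ℤ)}
    (hv : IsOrientation v) (q t : K) :
    commutatorKernel q t v * interaction q t 3 =
      (q * t) • (zPow (-v 2) * zPow (-v 2) * (zPow (v 1) - zPow (v 0)) *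
        ((∏ x ∈ {(0, 2), (1, 2)}, scalarEval (v x.1 - v x.2) (geomSeries (q * t))) *
          ∏ x ∈ {(0, 2), (1, 2)}, scalarEval (v x.1 - v x.2) (omegaM q t))) -
      (zPow (-v 1) - zPow (-v 2)) *
        ((∏ x ∈ {(0, 1), (0, 2)}, scalarEval (v x.1 - v x.2) (geomSeries (q * t))) *
          ∏ x ∈ {(0, 1), (0, 2)}, scalarEval (v x.1 - v x.2) (omegaM q t)) := by
  rw [hv.interaction_eq]
  refine Eq.trans ?_ ((isKernelFamily_of_strictAnti hv.strictAnti q t).identity_three.trans ?_) <;>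
    simp [commutatorKernel, pathKernel, Finset.prod_filter, Fintype.prod_prod_type,
      Fin.prod_univ_succ, smul_eq_scalar_mul]

theorem IsOrientation.commutatorKernel_mul_interaction_four {v : Fin 4 → Lex (Fin 4 → ℤ)}
    (hv : IsOrientation v) (q t : K) :
    commutatorKernel q t v * interaction q t 4 =
      (q * t) • (zPow (-v 2) * zPow (-v 3) * (zPow (v 1) - zPow (v 0)) *
        ((∏ x ∈ {(0, 2), (1, 2), (2, 3)}, scalarEval (v x.1 - v x.2) (geomSeries (q * t))) *
          ∏ x ∈ {(0, 2), (0, 3), (1, 2), (1, 3), (2, 3)},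
            scalarEval (v x.1 - v x.2) (omegaM q t))) -
      (q * t) • ((zPow (v 0) * zPow (-v 3) * (zPow (-v 1) - zPow (-v 2)) +
          zPow (-v 3) * zPow (-v 3) * (zPow (v 1) - zPow (v 2))) *
        ((∏ x ∈ {(0, 1), (0, 2), (1, 3), (2, 3)},
            scalarEval (v x.1 - v x.2) (geomSeries (q * t))) *
          ∏ x ∈ {(0, 1), (0, 2), (0, 3), (1, 3), (2, 3)},
            scalarEval (v x.1 - v x.2) (omegaM q t))) -
      (zPow (-v 2) - zPow (-v 3)) *
        ((∏ x ∈ {(0, 1), (1, 2), (1, 3)}, scalarEval (v x.1 - v x.2) (geomSeries (q * t))) *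
          ∏ x ∈ {(0, 1), (0, 2), (0, 3), (1, 2), (1, 3)},
            scalarEval (v x.1 - v x.2) (omegaM q t)) := by
  rw [hv.interaction_eq]
  refine Eq.trans ?_ ((isKernelFamily_of_strictAnti hv.strictAnti q t).identity_four.trans ?_)
  · simp [commutatorKernel, pathKernel, Finset.prod_filter, Fintype.prod_prod_type,
      Fin.prod_univ_succ, smul_eq_scalar_mul, mul_assoc]
  · simp [smul_eq_scalar_mul]

variable [CharZero K]

theorem commutatorVanishes_zero (q t : K) : CommutatorVanishes q t 0 := by
  intro c v hv
  obtain ⟨τ, hτ⟩ := hv.exists_permAddEquiv (Equiv.swap 0 1)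
  have hanti : IsReindex (permAddEquiv τ) (zPow (-v 0) - zPow (-v 1) : Series K 2) _ :=
    isReindex_zPow_neg_sub hτ rfl rfl
  have hzero := vertexOp_prodPow_mul_eq_zero hτ hv.strictAnti q t c hanti ∅ ∅ (by decide)
    (by decide)
  rw [Finset.prod_empty, Finset.prod_empty, mul_one, mul_one] at hzero
  rw [kernelOp, mul_assoc, hv.commutatorKernel_mul_interaction_two,
    mul_neg (prodPow 2 c : Series K 2), map_neg, hzero, neg_zero]

theorem commutatorVanishes_one (q t : K) : CommutatorVanishes q t 1 := by
  intro c v hv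
  obtain ⟨τ₀₁, hτ₀₁⟩ := hv.exists_permAddEquiv (Equiv.swap 0 1)
  obtain ⟨τ₁₂, hτ₁₂⟩ := hv.exists_permAddEquiv (Equiv.swap 1 2)
  have hu := isReindex_zPow_neg_apply (K := K) hτ₀₁ 2
  have hanti₀₁ : IsReindex (permAddEquiv τ₀₁)
      (zPow (-v 2) * zPow (-v 2) * (zPow (v 1) - zPow (v 0)) : Series K 3) _ :=
    (hu.mul hu).mul_neg (isReindex_zPow_sub hτ₀₁ rfl rfl)
  have hanti₁₂ : IsReindex (permAddEquiv τ₁₂) (zPow (-v 1) - zPow (-v 2) : Series K 3) _ :=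
    isReindex_zPow_neg_sub hτ₁₂ rfl rfl
  rw [kernelOp, mul_assoc, hv.commutatorKernel_mul_interaction_three, mul_sub, map_sub,
    mul_smul_comm, map_smul,
    vertexOp_prodPow_mul_eq_zero hτ₀₁ hv.strictAnti q t c hanti₀₁ _ _ (by decide) (by decide),
    vertexOp_prodPow_mul_eq_zero hτ₁₂ hv.strictAnti q t c hanti₁₂ _ _ (by decide) (by decide),
    smul_zero, sub_zero]

theorem commutatorVanishes_two (q t : K) : CommutatorVanishes q t 2 := by
  intro c v hv
  obtain ⟨τ₀₁, hτ₀₁⟩ := hv.exists_permAddEquiv (Equiv.swap 0 1)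
  obtain ⟨τ₁₂, hτ₁₂⟩ := hv.exists_permAddEquiv (Equiv.swap 1 2)
  obtain ⟨τ₂₃, hτ₂₃⟩ := hv.exists_permAddEquiv (Equiv.swap 2 3)
  have hu₀₁ := isReindex_zPow_neg_apply (K := K) hτ₀₁
  have hu₁₂ := isReindex_zPow_neg_apply (K := K) hτ₁₂
  have hanti₀₁ : IsReindex (permAddEquiv τ₀₁)
      (zPow (-v 2) * zPow (-v 3) * (zPow (v 1) - zPow (v 0)) : Series K 4) _ :=
    ((hu₀₁ 2).mul (hu₀₁ 3)).mul_neg (isReindex_zPow_sub hτ₀₁ rfl rfl)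
  have hanti₁₂ : IsReindex (permAddEquiv τ₁₂)
      (zPow (v 0) * zPow (-v 3) * (zPow (-v 1) - zPow (-v 2)) +
        zPow (-v 3) * zPow (-v 3) * (zPow (v 1) - zPow (v 2)) : Series K 4) _ :=
    (((isReindex_zPow_apply hτ₁₂ 0).mul (hu₁₂ 3)).mul_neg
      (isReindex_zPow_neg_sub hτ₁₂ rfl rfl)).add_neg
      (((hu₁₂ 3).mul (hu₁₂ 3)).mul_neg (isReindex_zPow_sub hτ₁₂ rfl rfl))
  have hanti₂₃ : IsReindex (permAddEquiv τ₂₃) (zPow (-v 2) - zPow (-v 3) : Series K 4) _ :=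
    isReindex_zPow_neg_sub hτ₂₃ rfl rfl
  rw [kernelOp, mul_assoc, hv.commutatorKernel_mul_interaction_four]
  iterate 2 rw [mul_sub, map_sub]
  iterate 2 rw [mul_smul_comm, map_smul]
  rw [vertexOp_prodPow_mul_eq_zero hτ₀₁ hv.strictAnti q t c hanti₀₁ _ _ (by decide) (by decide),
    vertexOp_prodPow_mul_eq_zero hτ₁₂ hv.strictAnti q t c hanti₁₂ _ _ (by decide) (by decide),
    vertexOp_prodPow_mul_eq_zero hτ₂₃ hv.strictAnti q t c hanti₂₃ _ _ (by decide) (by decide),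
    smul_zero, sub_zero, sub_zero]

theorem commutatorVanishes_of_lt_three (q t : K) {m : ℕ} (hm : m < 3) :
    CommutatorVanishes q t m := by
  interval_cases m
  exacts [commutatorVanishes_zero q t, commutatorVanishes_one q t, commutatorVanishes_two q t]

end Vanishing

end VertexOperators

theorem one_sub_tVar_mul_one_sub_qVar_ne_zero : (1 - tVar) * (1 - qVar) ≠ 0 := by
  have hX (i : Fin 2) :
      (1 : Qqt) - algebraMap (MvPolynomial (Fin 2) ℚ) Qqt (MvPolynomial.X i) ≠ 0 := by
    rw [← map_one (algebraMap (MvPolynomial (Fin 2) ℚ) Qqt), sub_ne_zero]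
    intro h
    have := congrArg MvPolynomial.constantCoeff (IsFractionRing.injective _ Qqt h)
    rw [map_one, MvPolynomial.constantCoeff_X] at this
    exact one_ne_zero this
  exact mul_ne_zero (hX 1) (hX 0)

end SymFun

end

theorem theorem3p2_general {K : Type*} [Field K] [CharZero K] {q t : K}
    (hM : (1 - t) * (1 - q) ≠ 0) {m n : ℕ} (hm : 1 ≤ m) (hm4 : m ≤ 4) (hmn : m.Coprime n) :
    SymFun.Q q t m n = SymFun.N q t m n := by
  obtain ⟨m, rfl⟩ := Nat.exists_eq_add_of_le' hm
  have hvanish : ∀ l < m, SymFun.CommutatorVanishes q t l :=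
    fun l hl => SymFun.commutatorVanishes_of_lt_three q t (by omega)
  have hm3 : m ≤ 3 := Nat.le_of_add_le_add_right hm4
  have hresidue : n % (m + 1) = 1 ∨ n % (m + 1) = m := by
    have hlt := Nat.mod_lt n m.succ_pos
    have hgcd : (n % (m + 1)).gcd (m + 1) = 1 := by rwa [← Nat.gcd_rec]
    interval_cases m <;> generalize n % _ = r at hlt hgcd ⊢ <;> interval_cases r <;>
      simp at hgcd ⊢
  rw [← Nat.div_add_mod n (m + 1)]
  rcases hresidue with h | h <;> rw [h]
  exacts [SymFun.Q_eq_N_of_modEq_one hM hvanish _, SymFun.Q_eq_N_of_modEq_neg_one hM hvanish _]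

theorem theorem3p2 (m n : ℕ) (hm : 1 ≤ m) (hm4 : m ≤ 4) (hn : 1 ≤ n) (hmn : Nat.Coprime m n) :
    SymFun.Q SymFun.qVar SymFun.tVar m n = SymFun.N SymFun.qVar SymFun.tVar m n :=
  theorem3p2_general SymFun.one_sub_tVar_mul_one_sub_qVar_ne_zero hm hm4 hmn
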